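/- A $(k,\ell)$-semigroup is a semigroup (with the empty word as identity $1$) given by finitely many generators $a_1,\dots,a_n$ and $k$ defining relations $A_1=1,\dots,A_k=1$, where each $A_i$ is a word in the generators of length at most $\ell$. It is called a $(k,\ell)$-group if every word is two-sided invertible in it. The identity problem for such a semigroup is the problem of deciding, for any two words in the generators, whether they are equal in the semigroup. The maximal subgroup of a $(k,\ell)$-semigroup is the group of its two-sided invertible elements. **Theorem.** If the natural numbers $k$ and $\ell$ are such that the identity problem is algorithmically solvable in every $(k,\ell)$-group, then there is an algorithm which for any $(k,\ell)$-semigroup $\Pi$ (given by its presentation) constructs a (presentation of a) $(k,\ell)$-group isomorphic to the maximal subgroup of $\Pi$. Moreover, this is an effective reduction: there is a single algorithm which, given any natural numbers $k,\ell$, any program that solves the identity problem in all $(k,\ell)$-groups (taking as input the presentation of the group and two words), and any $(k,\ell)$-semigroup $\Pi$, constructs a $(k,\ell)$-group isomorphic to the maximal subgroup of $\Pi$. -/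

import Mathlib

/-- A finite special monoid presentation, as a finite object on which an algorithm can work:
`P.1` is the number `n` of generators `0, …, n - 1`, and `P.2` is the list of the left-hand sides
`A` of the defining relations `A = 1`, each written as a list of letters. -/
abbrev SpecialPresentation : Type := ℕ × List (List ℕ)

namespace SpecialPresentation

/-- The alphabet of the presentation. -/
abbrev Alphabet (P : SpecialPresentation) : Type := Fin P.1

/-- The word in the raw letters `0, 1, 2, …` that spells the word `u` over the alphabet of `P`. -/
def spell {P : SpecialPresentation} (u : List P.Alphabet) : List ℕ := u.map Fin.val

/-- The defining relations `A = 1` on the free monoid over the alphabet. -/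
def Rel (P : SpecialPresentation) (u v : FreeMonoid P.Alphabet) : Prop :=
  spell u.toList ∈ P.2 ∧ v = 1

/-- The semigroup (with the empty word as identity) defined by the presentation. -/
abbrev Semigrp (P : SpecialPresentation) : Type := PresentedMonoid P.Rel

/-- The words `u` and `v` are equal in the semigroup defined by `P`. -/
def WordsEqual (P : SpecialPresentation) (u v : List P.Alphabet) : Prop :=
  PresentedMonoid.mk P.Rel (FreeMonoid.ofList u) = PresentedMonoid.mk P.Rel (FreeMonoid.ofList v)

/-- `P` presents a `(k, ℓ)`-semigroup: there are `k` defining relations `A = 1`, each left-hand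
side being a word over the alphabet of length at most `ℓ`. -/
def IsKLSemigroup (k ℓ : ℕ) (P : SpecialPresentation) : Prop :=
  P.2.length = k ∧ ∀ A ∈ P.2, A.length ≤ ℓ ∧ ∀ a ∈ A, a < P.1

/-- `P` presents a `(k, ℓ)`-group: a `(k, ℓ)`-semigroup with every element two-sided invertible. -/
def IsKLGroup (k ℓ : ℕ) (P : SpecialPresentation) : Prop :=
  IsKLSemigroup k ℓ P ∧ ∀ x : P.Semigrp, IsUnit x

/-- There is an algorithm that solves the identity problem in the semigroup defined by `P`. -/
def IdentityProblemDecidable (P : SpecialPresentation) : Prop :=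
  ComputablePred fun w : List P.Alphabet × List P.Alphabet => P.WordsEqual w.1 w.2

/-- The program `c` solves the identity problem in all `(k, ℓ)`-groups: run on a `(k, ℓ)`-group `P`
and two words over its alphabet, it halts, with output `1` if the words are equal in the group
and with output `0` otherwise. Nothing is required of `c` on any other input. -/
def SolvesIdentityProblem (k ℓ : ℕ) (c : Nat.Partrec.Code) : Prop :=
  ∀ P : SpecialPresentation, IsKLGroup k ℓ P → ∀ u v : List P.Alphabet,
    (P.WordsEqual u v → c.eval (Encodable.encode (P, spell u, spell v)) = Part.some 1) ∧
    (¬ P.WordsEqual u v → c.eval (Encodable.encode (P, spell u, spell v)) = Part.some 0)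

/-- `Q` presents a `(k, ℓ)`-group isomorphic to the maximal subgroup, that is, the group of units,
of the semigroup defined by `P`. -/
def IsKLGroupOfUnits (k ℓ : ℕ) (P Q : SpecialPresentation) : Prop :=
  IsKLGroup k ℓ Q ∧ Nonempty (Q.Semigrp ≃* P.Semigrpˣ)

end SpecialPresentation

/-! Let `M` be the semigroup of `P`. Each relator of `P` has value `1`, so it can be cut into
pieces: nonempty words that are units of `M` but have no invertible nonempty proper prefix. Let `Q`
have one generator for each value of a piece, and read each relator of `P`, cut into pieces, as a
relator of `Q`. The number of relators is unchanged and none becomes longer. Sending each generator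
to its value defines a homomorphism `ω` from `Q.Semigrp` to `M` whose values are units.

To see that `ω` is an isomorphism onto the units, regard the equations "piece = generator" as
rewriting rules on words with coefficients in `T = Q.Semigrp`. A piece that occurs inside another is
replaced there by its coefficient, until this is no longer possible. An overlap of two remaining
rules would be both left and right invertible, hence a unit, against the choice of the pieces; so
the rules do not overlap (`nonOverlapping_of_minimal`, `RuleInvariant.exists_minimal`). A
non-overlapping system makes `M` act on stacks, which serve as normal forms. Acting on the empty
stack shows that `ω` is injective, and a unit is found to have an empty stack, so that it lies in
the image of `ω` (`injective_and_units_of_nonOverlapping`, `exists_units_rules`).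

The construction cuts relators according to invertibility in `M`, for which no decision procedure is
given. The algorithm therefore searches for a presentation `Q` together with a finite certificate
that the argument applies to it. Equalities are certified by derivations. Only the absence of
overlaps needs inequalities, and these are inequalities in `Q`, supplied by the given program. The
certificate also proves that `Q` is a `(k, ℓ)`-group, so the program can be trusted there. Some
certificate exists (`exists_unitsCertificate`), and any certificate is sound
(`UnitsCertificate.isKLGroupOfUnits`).

For the first statement, there are only finitely many `(k, ℓ)`-groups, because each generator must
occur in a relator. Their separate decision procedures thus combine into one program. -/

/-! ### Non-overlapping rules and their action on stacks -/

section PatternSystems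

variable {X T K M : Type*}

/-- The value `g₀ x₁ g₁ x₂ ⋯ gₘ₋₁ xₘ` of the stack `[(xₘ, gₘ₋₁), …, (x₁, g₀)]`, top first. -/
def stackValue [Monoid K] (α : X → K) (β : T → K) : List (X × T) → K
  | [] => 1
  | p :: l => stackValue α β l * β p.2 * α p.1

theorem stackValue_append [Monoid K] (α : X → K) (β : T → K) (a b : List (X × T)) :
    stackValue α β (a ++ b) = stackValue α β b * stackValue α β a := by
  induction a with
  | nil => simp [stackValue]
  | cons p a ih => simp [stackValue, ih, mul_assoc]

theorem map_stackValue {K' : Type*} [Monoid K] [Monoid K'] (f : K →* K') (α : X → K) (β : T → K)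
    (l : List (X × T)) :
    f (stackValue α β l) = stackValue (fun x => f (α x)) (fun t => f (β t)) l := by
  induction l with
  | nil => simp [stackValue]
  | cons p a ih => simp [stackValue, ih]

variable [Monoid T] [Monoid M]

/-- A rule `(l, x, s)` stands for the identities `g x ⋯ = g s`, for all `g`; this says that `L = t`
is one of them. -/
def RuleInstance (S : Set (List (X × T) × X × T)) (L : List (X × T)) (t : T) : Prop :=
  ∃ l x g s, (l, x, s) ∈ S ∧ L = l ++ [(x, g)] ∧ t = g * s

/-- No two rule instances overlap or contain one another. -/
def NonOverlapping (S : Set (List (X × T) × X × T)) : Prop :=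
  ∀ L t L' t' c o, RuleInstance S L t → RuleInstance S L' t' → L = c ++ o → o ≠ [] →
    (o <+: L' ∨ L' <+: o) → c = [] ∧ o = L' ∧ t = t'

variable {S : Set (List (X × T) × X × T)}

theorem RuleInstance.ne_nil {L : List (X × T)} {t : T} (h : RuleInstance S L t) : L ≠ [] := by
  obtain ⟨l, x, g, s, -, rfl, -⟩ := h
  simp

/-- The bottom coefficient is the free variable of a rule; only the other coefficients are
prescribed. -/
theorem RuleInstance.change_bottom {l : List (X × T)} {x : X} {g t : T}
    (h : RuleInstance S (l ++ [(x, g)]) t) (g' : T) : ∃ t', RuleInstance S (l ++ [(x, g')]) t' := by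
  obtain ⟨l', x', g₁, s, hS, hL, -⟩ := h
  obtain ⟨rfl, h2⟩ := List.append_inj' hL rfl
  simp only [List.cons.injEq, Prod.mk.injEq, and_true] at h2
  obtain ⟨rfl, rfl⟩ := h2
  exact ⟨_, _, _, g', s, hS, rfl, rfl⟩

open Classical in
/-- Push the letter `x` on the stack and apply a rule to the top of the stack if possible. -/
noncomputable def pushLetter (S : Set (List (X × T) × X × T)) (x : X) (s : T × List (X × T)) :
    T × List (X × T) :=
  if h : ∃ q : T × List (X × T), ∃ l, (x, s.1) :: s.2 = l ++ q.2 ∧ RuleInstance S l q.1 then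
    h.choose else (1, (x, s.1) :: s.2)

theorem pushLetter_cases (S : Set (List (X × T) × X × T)) (x : X) (g : T) (L : List (X × T)) :
    (∃ l t R, (x, g) :: L = l ++ R ∧ RuleInstance S l t ∧ pushLetter S x (g, L) = (t, R)) ∨
    ((∀ l t R, (x, g) :: L = l ++ R → ¬ RuleInstance S l t) ∧
      pushLetter S x (g, L) = (1, (x, g) :: L)) := by
  by_cases h : ∃ q : T × List (X × T), ∃ l, (x, g) :: L = l ++ q.2 ∧ RuleInstance S l q.1
  · left
    obtain ⟨l, h1, h2⟩ := h.choose_spec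
    refine ⟨l, _, _, h1, h2, ?_⟩
    unfold pushLetter
    rw [dif_pos h]
  · right
    refine ⟨fun l t R h1 h2 => h ⟨(t, R), l, h1, h2⟩, ?_⟩
    unfold pushLetter
    rw [dif_neg h]

/-- Two instances at the top of one stack are comparable as prefixes, so they coincide; the choice
in `pushLetter` is immaterial. -/
theorem pushLetter_of_ruleInstance (hS : NonOverlapping S) {x : X} {g t : T}
    {L l R : List (X × T)} (h : (x, g) :: L = l ++ R) (hl : RuleInstance S l t) :
    pushLetter S x (g, L) = (t, R) := by
  rcases pushLetter_cases S x g L with ⟨l', t', R', h', hl', e⟩ | ⟨h', -⟩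
  · rw [e]
    obtain ⟨-, h1, h2⟩ := hS l t l' t' [] l hl hl' rfl hl.ne_nil
      (List.prefix_or_prefix_of_prefix ⟨R, h.symm⟩ ⟨R', h'.symm⟩)
    subst h1 h2
    rw [h] at h'
    rw [List.append_cancel_left h']
  · exact absurd hl (h' _ _ _ h)

/-- The right action of the letters on stacks. -/
noncomputable def letterAction (S : Set (List (X × T) × X × T)) (x : X) :
    (Function.End (T × List (X × T)))ᵐᵒᵖ :=
  MulOpposite.op (pushLetter S x)

/-- The right action of `T` on stacks. -/
def scaleAction (X T : Type*) [Monoid T] : T →* (Function.End (T × List (X × T)))ᵐᵒᵖ where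
  toFun t := MulOpposite.op fun s => (s.1 * t, s.2)
  map_one' := by
    apply MulOpposite.unop_injective
    funext s
    exact Prod.ext (mul_one s.1) rfl
  map_mul' a b := by
    apply MulOpposite.unop_injective
    funext s
    exact Prod.ext (mul_assoc s.1 a b).symm rfl

theorem unop_mul_apply {Ω : Type*} (a b : (Function.End Ω)ᵐᵒᵖ) (s : Ω) :
    (a * b).unop s = b.unop (a.unop s) := rfl

theorem unop_scaleAction (t g : T) (L : List (X × T)) :
    (scaleAction X T t).unop (g, L) = (g * t, L) := rfl

theorem unop_letterAction (x : X) (s : T × List (X × T)) :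
    (letterAction S x).unop s = pushLetter S x s := rfl

/-- In the opposite monoid factors act from left to right, so the instance is pushed from its bottom
up. Its own rule fires at the last letter and no rule can fire earlier. -/
theorem stackValue_action_of_ruleInstance (hS : NonOverlapping S) {L : List (X × T)} {t : T}
    (hL : RuleInstance S L t) (R : List (X × T)) :
    (stackValue (letterAction S) (scaleAction X T) L).unop (1, R) = (t, R) := by
  -- While only the bottom part `b` has been pushed, an instance at the top would overlap `L`.
  have key : ∀ b a, L = a ++ b → a ≠ [] →
      (stackValue (letterAction S) (scaleAction X T) b).unop (1, R) = (1, b ++ R) := by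
    intro b
    induction b with
    | nil => intro a _ _; rfl
    | cons p b ih =>
      obtain ⟨x, g⟩ := p
      intro a ha hne
      simp only [stackValue, unop_mul_apply]
      rw [ih (a ++ [(x, g)]) (by simp [ha]) (by simp), unop_scaleAction, one_mul,
        unop_letterAction]
      rcases pushLetter_cases S x g (b ++ R) with ⟨l', t', R', h', hl', -⟩ | ⟨-, e⟩
      · exfalso
        refine hne (hS L t l' t' a ((x, g) :: b) hL hl' ha (by simp) ?_).1
        exact List.prefix_or_prefix_of_prefix (l₃ := (x, g) :: b ++ R) ⟨R, rfl⟩ ⟨R', h'.symm⟩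
      · rw [e]; rfl
  obtain ⟨⟨x, g⟩, b, rfl⟩ := List.exists_cons_of_ne_nil hL.ne_nil
  simp only [stackValue, unop_mul_apply]
  rw [key b [(x, g)] rfl (by simp), unop_scaleAction, one_mul, unop_letterAction]
  exact pushLetter_of_ruleInstance hS rfl hL

/-- The current scalar `g` becomes the bottom coefficient, so the pushed rule is its instance at
`g`. -/
theorem stackValue_action_of_mem (hS : NonOverlapping S) {l : List (X × T)} {x : X} {t : T}
    (h : (l, x, t) ∈ S) :
    stackValue (letterAction S) (scaleAction X T) (l ++ [(x, 1)]) = scaleAction X T t := by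
  apply MulOpposite.unop_injective
  funext s
  obtain ⟨g, R⟩ := s
  have := stackValue_action_of_ruleInstance hS (L := l ++ [(x, g)]) ⟨l, x, g, t, h, rfl, rfl⟩ R
  rw [unop_scaleAction, ← this]
  simp only [stackValue_append, stackValue, unop_mul_apply, unop_scaleAction, one_mul, mul_one]

/-- No factor of the stack is a rule instance. -/
def StackIrreducible (S : Set (List (X × T) × X × T)) (L : List (X × T)) : Prop :=
  ∀ a l b t, L = a ++ (l ++ b) → ¬ RuleInstance S l t

theorem StackIrreducible.pushLetter {s : T × List (X × T)} (h : StackIrreducible S s.2) (x : X) :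
    StackIrreducible S (pushLetter S x s).2 := by
  obtain ⟨g, L⟩ := s
  rcases pushLetter_cases S x g L with ⟨l', t', R', h', hl', e⟩ | ⟨h', e⟩
  · rw [e]
    obtain ⟨p, l', rfl⟩ := List.exists_cons_of_ne_nil hl'.ne_nil
    simp only [List.cons_append, List.cons.injEq] at h'
    intro a l b t hab
    exact h (l' ++ a) l b t (by simp only at hab ⊢; rw [h'.2, hab, List.append_assoc])
  · rw [e]
    intro a l b t hab
    cases a with
    | nil => exact h' l t b hab
    | cons p a =>
      simp only [List.cons_append, List.cons.injEq] at hab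
      exact h a l b t hab.2

/-- A proper top segment of a rule instance at the bottom of the stack is never removed. -/
theorem bottom_pushLetter (hS : NonOverlapping S) {K₀ Y : List (X × T)} {x₀ : X} {g₀ g₁ t : T}
    (hp : RuleInstance S (K₀ ++ [(x₀, g₁)] ++ Y) t)
    {s : T × List (X × T)} (h : K₀ ++ [(x₀, g₀)] <:+ s.2) (x : X) :
    K₀ ++ [(x₀, g₀)] <:+ (pushLetter S x s).2 := by
  obtain ⟨g, L⟩ := s
  obtain ⟨R, rfl : R ++ (K₀ ++ [(x₀, g₀)]) = L⟩ := h
  rcases pushLetter_cases S x g (R ++ (K₀ ++ [(x₀, g₀)])) with ⟨l', t', R', h', hl', e⟩ | ⟨h', e⟩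
  · rw [e]
    rw [← List.cons_append] at h'
    -- Either the removed part `l'` reaches into the protected segment along `o`, or it stays above
    -- it. If it takes the whole stack, the bottom coefficient has to be changed to `g₁` before the
    -- overlap with the instance `hp` is visible.
    rcases List.append_eq_append_iff.1 h' with ⟨o, ho, hK⟩ | ⟨o, ho, hK⟩
    · by_cases hR : R' = []
      · exfalso
        subst hR
        rw [List.append_nil] at hK
        subst ho
        rw [← hK, ← List.append_assoc] at hl'
        obtain ⟨t₂, ht₂⟩ := hl'.change_bottom g₁
        have := (hS _ _ _ _ ((x, g) :: R) (K₀ ++ [(x₀, g₁)]) ht₂ hp (by simp) (by simp)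
          (Or.inl ⟨Y, rfl⟩)).1
        simp at this
      · by_cases hon : o = []
        · subst hon
          exact ⟨[], by simpa using hK⟩
        · exfalso
          obtain ⟨R'', q, rfl⟩ := (List.eq_nil_or_concat R').resolve_left hR
          rw [List.concat_eq_append, ← List.append_assoc] at hK
          obtain ⟨rfl, -⟩ := List.append_inj' hK rfl
          have := (hS _ _ _ _ ((x, g) :: R) o hl' hp ho hon
            (Or.inl ⟨R'' ++ [(x₀, g₁)] ++ Y, by simp⟩)).1
          simp at this
    · exact ⟨o, by simpa using hK.symm⟩
  · rw [e]
    exact ⟨(x, g) :: R, rfl⟩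

/-- Part of a normal form is pushed on another stack. As `L` is irreducible, a rule that fires must
reach below the pushed letters, so these form a proper top segment of an instance. This is the
segment that `bottom_pushLetter` protects. -/
theorem push_irreducible {L : List (X × T)} (hL : StackIrreducible S L) (h : T)
    (L' : List (X × T)) (l : List (X × T)) (x₀ : X) (g₀ : T) (hl : l ++ [(x₀, g₀)] <:+ L) :
    (stackValue (letterAction S) (scaleAction X T) (l ++ [(x₀, g₀)])).unop (h, L') =
      (1, l ++ [(x₀, h * g₀)] ++ L') ∨
    ∃ l₁ Y t, l₁ ++ [(x₀, g₀)] <:+ L ∧ Y ≠ [] ∧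
      RuleInstance S (l₁ ++ [(x₀, h * g₀)] ++ Y) t := by
  have key : ∀ l R l' t, l ++ [(x₀, g₀)] <:+ L → l ++ [(x₀, h * g₀)] ++ L' = l' ++ R →
      RuleInstance S l' t → ∃ Y, Y ≠ [] ∧ RuleInstance S (l ++ [(x₀, h * g₀)] ++ Y) t := by
    intro l R l' t hl e hl'
    obtain ⟨A, hA⟩ := hl
    rcases List.append_eq_append_iff.1 e with ⟨o, ho, hK⟩ | ⟨o, ho, hK⟩
    · refine ⟨o, ?_, ho ▸ hl'⟩
      rintro rfl
      rw [List.append_nil] at ho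
      rw [ho] at hl'
      obtain ⟨t₂, ht₂⟩ := hl'.change_bottom g₀
      exact hL A _ [] t₂ (by simp [← hA]) ht₂
    · exfalso
      by_cases hon : o = []
      · subst hon
        rw [List.append_nil] at ho
        rw [← ho] at hl'
        obtain ⟨t₂, ht₂⟩ := hl'.change_bottom g₀
        exact hL A _ [] t₂ (by simp [← hA]) ht₂
      · obtain ⟨o', q, rfl⟩ := (List.eq_nil_or_concat o).resolve_left hon
        rw [List.concat_eq_append, ← List.append_assoc] at ho
        obtain ⟨rfl, -⟩ := List.append_inj' ho rfl
        exact hL A _ (o' ++ [(x₀, g₀)]) t (by simp [← hA]) hl'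
  induction l with
  | nil =>
    simp only [List.nil_append, stackValue, unop_mul_apply, unop_scaleAction, unop_letterAction,
      MulOpposite.unop_one, Function.End.one_def, id]
    rcases pushLetter_cases S x₀ (h * g₀) L' with ⟨l', t', R', h', hl', -⟩ | ⟨-, e⟩
    · right
      obtain ⟨Y, hY, hr⟩ := key [] R' l' t' hl h' hl'
      exact ⟨[], Y, t', hl, hY, hr⟩
    · exact Or.inl e
  | cons p l ih =>
    obtain ⟨x, g⟩ := p
    have hl₂ : l ++ [(x₀, g₀)] <:+ L := by
      obtain ⟨A, hA⟩ := hl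
      exact ⟨A ++ [(x, g)], by simpa using hA⟩
    rcases ih hl₂ with e | e
    · simp only [List.cons_append, stackValue, unop_mul_apply, e, unop_scaleAction,
        unop_letterAction, one_mul]
      rcases pushLetter_cases S x g (l ++ [(x₀, h * g₀)] ++ L') with
        ⟨l', t', R', h', hl', -⟩ | ⟨-, e'⟩
      · right
        obtain ⟨Y, hY, hr⟩ := key ((x, g) :: l) R' l' t' hl h' hl'
        exact ⟨_, Y, t', hl, hY, hr⟩
      · exact Or.inl e'
    · exact Or.inr e

/-- The hypotheses say that `M` is generated by the letters `χ x`, that the rules hold in `M`,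
and that `M` acts on stacks. -/
theorem injective_and_units_of_nonOverlapping (hS : NonOverlapping S) (χ : X → M) (ω : T →* M)
    (hχ : Submonoid.closure (Set.range χ) = ⊤)
    (hrule : ∀ l x t, (l, x, t) ∈ S → stackValue χ ω (l ++ [(x, 1)]) = ω t)
    (A : M →* (Function.End (T × List (X × T)))ᵐᵒᵖ)
    (hAχ : ∀ x, A (χ x) = letterAction S x) (hAω : ∀ t, A (ω t) = scaleAction X T t) :
    Function.Injective ω ∧ ∀ u : M, IsUnit u → ∃ t, ω t = u := by
  have hinst : ∀ L t, RuleInstance S L t → stackValue χ ω L = ω t := by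
    rintro L t ⟨l, x, g, s, hs, rfl, rfl⟩
    have := hrule l x s hs
    simp only [stackValue_append, stackValue, map_one, one_mul] at this ⊢
    rw [map_mul, ← this, mul_assoc]
  -- The action on stacks follows right multiplication in `M`.
  have hval : ∀ (m : M) (s : T × List (X × T)),
      stackValue χ ω ((A m).unop s).2 * ω ((A m).unop s).1 =
        stackValue χ ω s.2 * ω s.1 * m := by
    intro m
    induction (hχ ▸ Submonoid.mem_top m : m ∈ Submonoid.closure (Set.range χ))
      using Submonoid.closure_induction with
    | mem x hx =>
      obtain ⟨x, rfl⟩ := hx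
      rintro ⟨g, L⟩
      rw [hAχ, unop_letterAction]
      rcases pushLetter_cases S x g L with ⟨l', t', R', h', hl', e⟩ | ⟨-, e⟩
      · rw [e, ← hinst _ _ hl', ← stackValue_append, ← h']
        rfl
      · rw [e]
        simp [stackValue]
    | one => simp [Function.End.one_def]
    | mul x y _ _ hx hy =>
      intro s
      rw [map_mul, unop_mul_apply, hy, hx, mul_assoc]
  have hirr : ∀ (m : M) (s : T × List (X × T)), StackIrreducible S s.2 →
      StackIrreducible S ((A m).unop s).2 := by
    intro m
    induction (hχ ▸ Submonoid.mem_top m : m ∈ Submonoid.closure (Set.range χ))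
      using Submonoid.closure_induction with
    | mem x hx =>
      obtain ⟨x, rfl⟩ := hx
      intro s hs
      rw [hAχ, unop_letterAction]
      exact hs.pushLetter x
    | one => intro s hs; simpa [Function.End.one_def] using hs
    | mul x y _ _ hx hy =>
      intro s hs
      rw [map_mul, unop_mul_apply]
      exact hy _ (hx _ hs)
  have hnil : StackIrreducible S [] := by
    intro a l b t h hl
    simp only [List.nil_eq, List.append_eq_nil_iff] at h
    exact hl.ne_nil h.2.1
  refine ⟨fun t t' h => ?_, fun u hu => ?_⟩
  · have h1 := congrArg (fun m => ((A m).unop ((1 : T), ([] : List (X × T)))).1) h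
    simpa [hAω, unop_scaleAction] using h1
  · obtain ⟨⟨u, v, huv, hvu⟩, rfl⟩ := hu
    simp only
    generalize hs : (A u).unop ((1 : T), ([] : List (X × T))) = s
    have hs₂ : StackIrreducible S s.2 := hs ▸ hirr u _ hnil
    have hsu : stackValue χ ω s.2 * ω s.1 = u := by
      have := hval u (1, [])
      rw [hs] at this
      simpa [stackValue] using this
    have hsv : (A v).unop s = (1, []) := by
      rw [← hs, ← unop_mul_apply, ← map_mul, huv, map_one]
      rfl
    obtain ⟨g, L⟩ := s
    rcases List.eq_nil_or_concat L with rfl | ⟨l, ⟨x₀, g₀⟩, rfl⟩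
    · exact ⟨g, by simpa [stackValue] using hsu⟩
    · exfalso
      rw [List.concat_eq_append] at *
      generalize hs' : (A v).unop ((1 : T), ([] : List (X × T))) = s'
      have hs'u : (A u).unop s' = (1, []) := by
        rw [← hs', ← unop_mul_apply, ← map_mul, hvu, map_one]
        rfl
      obtain ⟨h, L'⟩ := s'
      -- Push the normal form of `u` on the stack of `v`. If no rule fires, the result is nonempty,
      -- against `v * u = 1`. Otherwise a bottom segment of the stack of `u` can never be removed,
      -- so `v` cannot clear that stack, against `u * v = 1`.
      rcases push_irreducible hs₂ h L' l x₀ g₀ (List.suffix_refl _) with e | ⟨l₁, Y, t, h1, -, h3⟩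
      · rw [← hsu, map_mul, map_stackValue, unop_mul_apply] at hs'u
        simp only [hAχ, hAω] at hs'u
        rw [e, unop_scaleAction] at hs'u
        simp at hs'u
      · have hbot : ∀ (m : M) (s : T × List (X × T)), l₁ ++ [(x₀, g₀)] <:+ s.2 →
            l₁ ++ [(x₀, g₀)] <:+ ((A m).unop s).2 := by
          intro m
          induction (hχ ▸ Submonoid.mem_top m : m ∈ Submonoid.closure (Set.range χ))
            using Submonoid.closure_induction with
          | mem x hx =>
            obtain ⟨x, rfl⟩ := hx
            intro s hs
            rw [hAχ, unop_letterAction]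
            exact bottom_pushLetter hS h3 hs x
          | one => intro s hs; simpa [Function.End.one_def] using hs
          | mul x y _ _ hx hy =>
            intro s hs
            rw [map_mul, unop_mul_apply]
            exact hy _ (hx _ hs)
        have := hbot v _ h1
        rw [hsv] at this
        simp at this

end PatternSystems

/-! ### Interreduction of minimal invertible words -/

section MinimalRules

variable {X T M : Type} [Monoid T] [Monoid M]

/-- Stacks are listed top first, so `o` is a word prefix of `L`. If it is also a word suffix of
`L'`, its value has a right and a left inverse. Being a unit, it cannot be a proper prefix of `L`,
nor can it leave a nonempty prefix in `L'`. Containment is excluded by `hfac` in the interior and by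
`hpre` at the two ends. -/
theorem nonOverlapping_of_minimal {S : Set (List (X × T) × X × T)} (χ : X → M) (ω : T →* M)
    (hunit : ∀ t, IsUnit (ω t))
    (hval : ∀ L t, RuleInstance S L t → stackValue χ ω L = ω t)
    (hpre : ∀ L t a b, RuleInstance S L t → L = a ++ b → a ≠ [] → b ≠ [] →
      ¬ IsUnit (stackValue χ ω b))
    (hfac : ∀ L t L' t' a b, RuleInstance S L t → RuleInstance S L' t' → L = a ++ (L' ++ b) →
      a = [] ∨ b = [])
    (hfun : ∀ L t t', RuleInstance S L t → RuleInstance S L t' → t = t') :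
    NonOverlapping S := by
  intro L t L' t' c o hL hL' hco ho hpfx
  have uL : IsUnit (stackValue χ ω L) := by rw [hval L t hL]; exact hunit t
  have uL' : IsUnit (stackValue χ ω L') := by rw [hval L' t' hL']; exact hunit t'
  rcases hpfx with ⟨d, rfl⟩ | ⟨d, rfl⟩
  · rw [hco, stackValue_append] at uL
    rw [stackValue_append] at uL'
    have uo : IsUnit (stackValue χ ω o) := by
      obtain ⟨y, hy⟩ := uL.exists_right_inv
      obtain ⟨z, hz⟩ := uL'.exists_left_inv
      exact isUnit_iff_exists_and_exists.2 ⟨⟨_, by rwa [mul_assoc] at hy⟩,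
        ⟨_, by rwa [← mul_assoc] at hz⟩⟩
    have hc : c = [] := by
      by_contra hc
      exact hpre L t c o hL hco hc ho uo
    have hd : d = [] := by
      by_contra hd
      refine hpre _ t' o d hL' rfl ho hd ?_
      obtain ⟨v, hv⟩ := uo
      rw [← hv] at uL'
      exact (Units.isUnit_mul_units _ v).1 uL'
    subst hc hd hco
    refine ⟨rfl, by simp, ?_⟩
    rw [List.append_nil] at hL'
    exact hfun _ _ _ hL hL'
  · have hd : d = [] := by
      by_contra hd
      rcases hfac L t L' t' c d hL hL' hco with rfl | h
      · rw [hco, List.nil_append, stackValue_append] at uL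
        refine hpre L t L' d hL hco hL'.ne_nil hd ?_
        obtain ⟨v, hv⟩ := uL'
        rw [← hv] at uL
        exact (Units.isUnit_mul_units _ v).1 uL
      · exact hd h
    subst hd
    have hc : c = [] := by
      by_contra hc
      rw [List.append_nil] at hco
      exact hpre L t c L' hL hco hc hL'.ne_nil uL'
    subst hc
    refine ⟨rfl, by simp, ?_⟩
    rw [List.append_nil, List.nil_append] at hco
    subst hco
    exact hfun _ _ _ hL hL'

/-- The rules `F w = φ w` for `w ∈ D`. -/
def ruleSet (D : Finset (List X)) (φ : List X → T) (F : List X → List (X × T)) :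
    Set (List (X × T) × X × T) :=
  {r | ∃ w ∈ D, F w = r.1 ++ [(r.2.1, 1)] ∧ r.2.2 = φ w}

/-- The invariants of interreduction of the rules `w = φ w`, `w ∈ D`, where the words in `D` are
units of `M` without invertible proper prefixes. -/
structure RuleInvariant (D : Finset (List X)) (χ : X → M) (ω : T →* M) (φ : List X → T)
    (F : List X → List (X × T)) : Prop where
  bottom : ∀ w ∈ D, ∃ l x, F w = l ++ [(x, 1)]
  value : ∀ w ∈ D, stackValue χ ω (F w) = ω (φ w)
  prefix_not_isUnit : ∀ w ∈ D, ∀ a b, F w = a ++ b → a ≠ [] → b ≠ [] → ¬ IsUnit (stackValue χ ω b)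
  generate : ∀ (K : Type) [Monoid K] (α : X → K) (β : T →* K),
    (∀ w ∈ D, stackValue α β (F w) = β (φ w)) → ∀ w ∈ D, (w.map α).prod = β (φ w)

variable {D : Finset (List X)} {χ : X → M} {ω : T →* M} {φ : List X → T}

theorem stackValue_replace {K : Type*} [Monoid K] (α : X → K) (β : T →* K) {l' : List (X × T)}
    {x' : X} {t : T} (h : stackValue α β (l' ++ [(x', 1)]) = β t) (a b : List (X × T)) (x : X)
    (g g' : T) :
    stackValue α β (a ++ [(x, g * t * g')] ++ b) =
      stackValue α β (a ++ [(x, g')] ++ (l' ++ [(x', g)]) ++ b) := by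
  simp only [stackValue_append, stackValue, map_one, one_mul, map_mul] at h ⊢
  rw [← h]
  simp only [mul_assoc]

/-- The value of the inner factor is absorbed into the coefficient before the next letter `x`.
Proper prefixes of the new word have values of proper prefixes of the old one. As the rule of `w'`
is kept, the old rule of `w` can be recovered in every monoid, which preserves `generate`. The
condition `b ≠ []` keeps the bottom letter with its coefficient `1`. -/
theorem RuleInvariant.replace {F : List X → List (X × T)} (hF : RuleInvariant D χ ω φ F)
    {w w' : List X} (hw : w ∈ D) (hw' : w' ∈ D) {a b l' : List (X × T)} {x x' : X} {g g' : T}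
    (hww' : F w = a ++ [(x, g')] ++ (l' ++ [(x', g)]) ++ b) (hl' : F w' = l' ++ [(x', 1)])
    (hb : b ≠ []) [DecidableEq (List X)] :
    RuleInvariant D χ ω φ (Function.update F w (a ++ [(x, g * φ w' * g')] ++ b)) := by
  have hne : w' ≠ w := by
    rintro rfl
    have := congrArg List.length (hww'.symm.trans hl')
    simp at this
    omega
  have hval' := hF.value w' hw'
  rw [hl'] at hval'
  have hgen : ∀ (K : Type) [Monoid K] (α : X → K) (β : T →* K),
      (stackValue α β (F w') = β (φ w')) →
      stackValue α β (a ++ [(x, g * φ w' * g')] ++ b) = stackValue α β (F w) := by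
    intro K _ α β h
    rw [hl'] at h
    rw [hww', stackValue_replace α β h]
  refine ⟨fun v hv => ?_, fun v hv => ?_, fun v hv => ?_, fun K _ α β h v hv => ?_⟩
  · rcases eq_or_ne v w with rfl | hvw
    · obtain ⟨l, y, hly⟩ := hF.bottom v hv
      obtain ⟨b', q, rfl⟩ := (List.eq_nil_or_concat b).resolve_left hb
      rw [hww', List.concat_eq_append, ← List.append_assoc] at hly
      obtain ⟨-, h2⟩ := List.append_inj' hly rfl
      exact ⟨a ++ [(x, g * φ w' * g')] ++ b', y, by simp at h2; simp [h2]⟩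
    · rw [Function.update_of_ne hvw]
      exact hF.bottom v hv
  · rcases eq_or_ne v w with rfl | hvw
    · rw [Function.update_self, hgen M χ ω (hF.value w' hw'), hF.value v hv]
    · rw [Function.update_of_ne hvw]
      exact hF.value v hv
  · rcases eq_or_ne v w with rfl | hvw
    · rw [Function.update_self]
      intro c d hcd hc hd
      rcases List.append_eq_append_iff.1 hcd with ⟨o, ho, hK⟩ | ⟨o, ho, hK⟩
      · refine hF.prefix_not_isUnit v hv (a ++ [(x, g')] ++ (l' ++ [(x', g)]) ++ o) d ?_ (by simp) hd
        rw [hww', hK]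
        simp
      · rcases List.eq_nil_or_concat o with rfl | ⟨o', q, rfl⟩
        · refine hF.prefix_not_isUnit v hv (a ++ [(x, g')] ++ (l' ++ [(x', g)])) d ?_ (by simp) hd
          rw [hww', hK]
          simp
        · rw [List.concat_eq_append, ← List.append_assoc] at ho
          obtain ⟨h1, h2⟩ := List.append_inj' ho rfl
          rw [hK, List.concat_eq_append, ← h2, stackValue_replace χ ω hval']
          refine hF.prefix_not_isUnit v hv c _ ?_ hc (by simp)
          rw [hww', h1]
          simp
    · rw [Function.update_of_ne hvw]
      exact hF.prefix_not_isUnit v hv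
  · refine hF.generate K α β (fun u hu => ?_) v hv
    have hw'' := h w' hw'
    rw [Function.update_of_ne hne] at hw''
    rcases eq_or_ne u w with rfl | huw
    · have := h u hu
      rwa [Function.update_self, hgen K α β hw''] at this
    · have := h u hu
      rwa [Function.update_of_ne huw] at this

/-- Each replacement lowers the total length of the left-hand sides. -/
theorem RuleInvariant.exists_minimal {F : List X → List (X × T)}
    (hF : RuleInvariant D χ ω φ F) :
    ∃ F, RuleInvariant D χ ω φ F ∧ ∀ w ∈ D, ∀ w' ∈ D, ∀ l' x' g a b,
      F w' = l' ++ [(x', 1)] → F w = a ++ (l' ++ [(x', g)] ++ b) → a = [] ∨ b = [] := by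
  classical
  induction hn : ∑ w ∈ D, (F w).length using Nat.strong_induction_on generalizing F with
  | _ n ih =>
    by_cases h : ∀ w ∈ D, ∀ w' ∈ D, ∀ l' x' g a b,
      F w' = l' ++ [(x', 1)] → F w = a ++ (l' ++ [(x', g)] ++ b) → a = [] ∨ b = []
    · exact ⟨F, hF, h⟩
    · push Not at h
      obtain ⟨w, hw, w', hw', l', x', g, a, b, h1, h2, ha, hb⟩ := h
      obtain ⟨a, ⟨x, g'⟩, rfl⟩ := (List.eq_nil_or_concat a).resolve_left ha
      have h3 : F w = a ++ [(x, g')] ++ (l' ++ [(x', g)]) ++ b := by rw [h2]; simp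
      refine ih _ ?_ (hF.replace hw hw' h3 h1 hb) rfl
      rw [← hn]
      refine Finset.sum_lt_sum (fun u _ => ?_) ⟨w, hw, ?_⟩
      · rcases eq_or_ne u w with rfl | huw
        · rw [Function.update_self, h3]
          simp only [List.length_append, List.length_cons]
          omega
        · rw [Function.update_of_ne huw]
      · rw [Function.update_self, h3]
        simp

theorem RuleInvariant.nonOverlapping {F : List X → List (X × T)} (hF : RuleInvariant D χ ω φ F)
    (hunit : ∀ t, IsUnit (ω t)) (hφ : ∀ w ∈ D, ∀ w' ∈ D, ω (φ w) = ω (φ w') → φ w = φ w')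
    (hfac : ∀ w ∈ D, ∀ w' ∈ D, ∀ l' x' g a b,
      F w' = l' ++ [(x', 1)] → F w = a ++ (l' ++ [(x', g)] ++ b) → a = [] ∨ b = []) :
    NonOverlapping (ruleSet D φ F) := by
  have hbot : ∀ (b : List (X × T)) x g, stackValue χ ω (b ++ [(x, g)]) =
      ω g * stackValue χ ω (b ++ [(x, 1)]) := by
    intro b x g
    simp [stackValue_append, stackValue, mul_assoc]
  refine nonOverlapping_of_minimal χ ω hunit ?_ ?_ ?_ ?_
  · rintro L t ⟨l, x, g, s, ⟨w, hw, h1, rfl : s = φ w⟩, rfl, rfl⟩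
    rw [hbot, ← show F w = l ++ [(x, 1)] from h1, hF.value w hw, map_mul]
  · rintro L t a b ⟨l, x, g, s, ⟨w, hw, h1, rfl : s = φ w⟩, rfl, rfl⟩ hab ha hb hu
    obtain ⟨b, q, rfl⟩ := (List.eq_nil_or_concat b).resolve_left hb
    rw [List.concat_eq_append] at *
    rw [← List.append_assoc] at hab
    obtain ⟨rfl, h2⟩ := List.append_inj' hab rfl
    rw [← h2, hbot] at hu
    refine hF.prefix_not_isUnit w hw a (b ++ [(x, 1)]) (h1.trans (by simp)) ha (by simp) ?_
    obtain ⟨v, hv⟩ := hunit g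
    rw [← hv] at hu
    exact (Units.isUnit_units_mul v _).1 hu
  · rintro L t L' t' a b ⟨l, x, g, s, ⟨w, hw, h1, rfl : s = φ w⟩, rfl, rfl⟩
      ⟨l', x', g', s', ⟨w', hw', h1', rfl : s' = φ w'⟩, rfl, rfl⟩ hab
    rcases List.eq_nil_or_concat b with rfl | ⟨b, q, rfl⟩
    · exact Or.inr rfl
    · rw [List.concat_eq_append, ← List.append_assoc, ← List.append_assoc] at hab
      obtain ⟨rfl, h2⟩ := List.append_inj' hab rfl
      rcases hfac w hw w' hw' l' x' g' a (b ++ [(x, 1)]) h1' (h1.trans (by simp)) with h | h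
      · exact Or.inl h
      · simp at h
  · rintro L t t' ⟨l, x, g, s, ⟨w, hw, h1, rfl : s = φ w⟩, rfl, rfl⟩
      ⟨l', x', g', s', ⟨w', hw', h1', rfl : s' = φ w'⟩, hL, rfl⟩
    obtain ⟨rfl, h2⟩ := List.append_inj' hL rfl
    simp only [List.cons.injEq, Prod.mk.injEq, and_true] at h2
    obtain ⟨rfl, rfl⟩ := h2
    -- Equal left-hand sides have equal values in `M`, and `φ` separates no two pieces with equal
    -- values.
    rw [hφ w hw w' hw']
    rw [← hF.value w hw, ← hF.value w' hw', h1, h1']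

theorem stackValue_reverse_map_one {K : Type*} [Monoid K] (α : X → K) (β : T →* K) (w : List X) :
    stackValue α β (w.reverse.map fun x => (x, 1)) = (w.map α).prod := by
  induction w with
  | nil => simp [stackValue]
  | cons x w ih =>
    simp only [List.reverse_cons, List.map_append, stackValue_append, ih]
    simp [stackValue]

/-- The last clause ranges over all monoids because it will be applied to the endomorphisms of the
set of stacks, before anything is known about `ω`. -/
theorem exists_nonOverlapping_rules (hunit : ∀ t, IsUnit (ω t))
    (hφ : ∀ w ∈ D, ∀ w' ∈ D, ω (φ w) = ω (φ w') → φ w = φ w')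
    (hval : ∀ w ∈ D, (w.map χ).prod = ω (φ w)) (hne : [] ∉ D)
    (hpre : ∀ a b, a ++ b ∈ D → a ≠ [] → b ≠ [] → ¬ IsUnit (a.map χ).prod) :
    ∃ rules : List (List (X × T) × X × T), NonOverlapping {r | r ∈ rules} ∧
      (∀ r ∈ rules, stackValue χ ω (r.1 ++ [(r.2.1, 1)]) = ω r.2.2) ∧
      ∀ (K : Type) [Monoid K] (α : X → K) (β : T →* K),
        (∀ r ∈ rules, stackValue α β (r.1 ++ [(r.2.1, 1)]) = β r.2.2) →
        ∀ w ∈ D, (w.map α).prod = β (φ w) := by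
  have hF₀ : RuleInvariant D χ ω φ (fun w => w.reverse.map fun x => (x, 1)) := by
    refine ⟨fun w hw => ?_, fun w hw => ?_, fun w hw a b hab ha hb => ?_,
      fun K _ α β h w hw => ?_⟩
    · obtain ⟨x, w, rfl⟩ := List.exists_cons_of_ne_nil (fun h => hne (h ▸ hw) : w ≠ [])
      exact ⟨w.reverse.map fun x => (x, 1), x, by simp⟩
    · rw [stackValue_reverse_map_one, hval w hw]
    · obtain ⟨a', b', h1, rfl, rfl⟩ := List.map_eq_append_iff.1 hab
      rw [List.reverse_eq_iff, List.reverse_append] at h1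
      subst h1
      have := stackValue_reverse_map_one χ ω b'.reverse
      rw [List.reverse_reverse] at this
      rw [this]
      exact hpre _ _ hw (by simpa using hb) (by simpa using ha)
    · rw [← h w hw, stackValue_reverse_map_one]
  obtain ⟨F, hF, hfac⟩ := hF₀.exists_minimal
  choose l x hlx using hF.bottom
  let rule : {w // w ∈ D} → List (X × T) × X × T := fun w => (l w w.2, x w w.2, φ w)
  have hset : {r | r ∈ D.attach.toList.map rule} = ruleSet D φ F := by
    ext ⟨l', x', t'⟩
    simp only [List.mem_map, Finset.mem_toList, Finset.mem_attach, true_and, Set.mem_ofPred_eq,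
      ruleSet, rule, Prod.mk.injEq]
    constructor
    · rintro ⟨⟨w, hw⟩, rfl, rfl, rfl⟩
      exact ⟨w, hw, hlx w hw, rfl⟩
    · rintro ⟨w, hw, h, rfl⟩
      rw [hlx w hw] at h
      obtain ⟨h1, h2⟩ := List.append_inj' h rfl
      simp only [List.cons.injEq, Prod.mk.injEq, and_true] at h2
      exact ⟨⟨w, hw⟩, h1, h2, rfl⟩
  refine ⟨D.attach.toList.map rule, ?_, ?_, ?_⟩
  · rw [hset]
    exact hF.nonOverlapping hunit hφ hfac
  · intro r hr
    obtain ⟨⟨w, hw⟩, -, rfl⟩ := List.mem_map.1 hr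
    simp only [rule]
    rw [← hF.value w hw, hlx w hw]
  · intro K _ α β h
    refine hF.generate K α β fun w hw => ?_
    have := h (rule ⟨w, hw⟩) (List.mem_map.2 ⟨⟨w, hw⟩, by simp, rfl⟩)
    simp only [rule] at this
    rwa [← hlx w hw] at this

/-- A word that is a unit is a product of units without invertible proper prefixes. -/
theorem exists_minimal_unit_factorization (χ : X → M) (u : List X)
    (hu : IsUnit (u.map χ).prod) :
    ∃ ws : List (List X), ws.flatten = u ∧ ∀ w ∈ ws, w ≠ [] ∧ IsUnit (w.map χ).prod ∧
      ∀ a b, w = a ++ b → a ≠ [] → b ≠ [] → ¬ IsUnit (a.map χ).prod := by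
  classical
  induction hn : u.length using Nat.strong_induction_on generalizing u with
  | _ n ih =>
    by_cases hnil : u = []
    · exact ⟨[], by simp [hnil], by simp⟩
    have hex : ∃ m, ∃ a b, u = a ++ b ∧ a.length = m ∧ a ≠ [] ∧ IsUnit (a.map χ).prod :=
      ⟨u.length, u, [], by simp, rfl, hnil, hu⟩
    -- Cut off the shortest nonempty invertible prefix; the rest is again a unit.
    obtain ⟨a, b, rfl, hlen, ha, hau⟩ := Nat.find_spec hex
    have hbu : IsUnit (b.map χ).prod := by
      obtain ⟨v, hv⟩ := hau
      rw [List.map_append, List.prod_append, ← hv] at hu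
      exact (Units.isUnit_units_mul v _).1 hu
    have hapos : 0 < a.length := List.length_pos_iff.2 ha
    obtain ⟨ws, rfl, hws⟩ := ih b.length (by rw [← hn, List.length_append]; omega) b hbu rfl
    refine ⟨a :: ws, by simp, ?_⟩
    intro w hw
    rcases List.mem_cons.1 hw with rfl | hw
    · refine ⟨ha, hau, ?_⟩
      rintro c d rfl hc hd hcu
      refine Nat.find_min hex (m := c.length) ?_ ⟨c, d ++ ws.flatten, by simp, rfl, hc, hcu⟩
      rw [← hlen, List.length_append]
      have := List.length_pos_iff.2 hd
      omega
    · exact hws w hw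

end MinimalRules

theorem nonempty_mulEquiv_units {T M : Type*} [Monoid T] [Monoid M] (ω : T →* M)
    (hω : Function.Injective ω) (hT : ∀ t : T, IsUnit t) (hM : ∀ u : M, IsUnit u → ∃ t, ω t = u) :
    Nonempty (T ≃* Mˣ) := by
  refine ⟨MulEquiv.ofBijective (IsUnit.liftRight ω fun t => (hT t).map ω) ⟨?_, ?_⟩⟩
  · intro a b h
    apply hω
    exact congrArg Units.val h
  · intro u
    obtain ⟨t, ht⟩ := hM u u.isUnit
    exact ⟨t, Units.ext ht⟩

/-! ### The group of units of a special presentation -/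

namespace SpecialPresentation

/-- The class of a raw letter; letters outside the alphabet are sent to `1`. -/
noncomputable def letterClass (P : SpecialPresentation) (a : ℕ) : P.Semigrp :=
  if h : a < P.1 then PresentedMonoid.of P.Rel ⟨a, h⟩ else 1

/-- The class of a raw word. -/
noncomputable def wordClass (P : SpecialPresentation) (w : List ℕ) : P.Semigrp :=
  (w.map P.letterClass).prod

variable {P Q : SpecialPresentation} {k ℓ : ℕ}

theorem letterClass_val (a : P.Alphabet) : P.letterClass a.1 = PresentedMonoid.of P.Rel a := by
  simp [letterClass]

theorem mk_ofList (u : List P.Alphabet) : PresentedMonoid.mk P.Rel (FreeMonoid.ofList u) =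
    (u.map (PresentedMonoid.of P.Rel)).prod := by
  induction u with
  | nil => simp
  | cons a u ih => rw [FreeMonoid.ofList_cons, map_mul, ih, List.map_cons, List.prod_cons]; rfl

theorem wordClass_spell (u : List P.Alphabet) : P.wordClass (spell u) =
    PresentedMonoid.mk P.Rel (FreeMonoid.ofList u) := by
  rw [mk_ofList, wordClass, spell, List.map_map]
  congr 1
  exact List.map_congr_left fun a _ => letterClass_val a

theorem wordClass_append (u v : List ℕ) :
    P.wordClass (u ++ v) = P.wordClass u * P.wordClass v := by
  simp [wordClass]

theorem exists_spell {A : List ℕ} (hA : ∀ a ∈ A, a < P.1) : ∃ u : List P.Alphabet, spell u = A := by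
  induction A with
  | nil => exact ⟨[], rfl⟩
  | cons a A ih =>
    obtain ⟨u, rfl⟩ := ih fun b hb => hA b (List.mem_cons_of_mem _ hb)
    exact ⟨⟨a, hA a List.mem_cons_self⟩ :: u, rfl⟩

theorem spell_injective : Function.Injective (spell (P := P)) :=
  List.map_injective_iff.2 Fin.val_injective

theorem mk_relator {u : List P.Alphabet} (hu : spell u ∈ P.2) :
    PresentedMonoid.mk P.Rel (FreeMonoid.ofList u) = 1 :=
  (PresentedMonoid.mk_eq_mk_of_rel (rels := P.Rel) (y := 1) ⟨hu, rfl⟩).trans (map_one _)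

theorem wordClass_relator (hP : IsKLSemigroup k ℓ P) {A : List ℕ} (hA : A ∈ P.2) :
    P.wordClass A = 1 := by
  obtain ⟨u, rfl⟩ := exists_spell (hP.2 A hA).2
  rw [wordClass_spell, mk_relator hA]

theorem isUnit_of_forall_of {N : Type*} [Monoid N] (f : P.Semigrp →* N)
    (h : ∀ a, IsUnit (f (PresentedMonoid.of P.Rel a))) (x : P.Semigrp) : IsUnit (f x) := by
  have : (⊤ : Submonoid P.Semigrp) ≤ (IsUnit.submonoid N).comap f := by
    rw [← PresentedMonoid.closure_range_of, Submonoid.closure_le]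
    rintro _ ⟨a, rfl⟩
    exact h a
  exact this (Submonoid.mem_top x)

/-- By `hrel` the action of letters descends to the semigroup of `P`; by `hom` the elements `ω t`
then act by scaling. -/
theorem injective_and_units_of_rules {S : Set (List (P.Alphabet × Q.Semigrp) × P.Alphabet × Q.Semigrp)}
    (hS : NonOverlapping S) (ω : Q.Semigrp →* P.Semigrp) (om : Q.Alphabet → List P.Alphabet)
    (hω : ∀ b, ω (PresentedMonoid.of Q.Rel b) =
      PresentedMonoid.mk P.Rel (FreeMonoid.ofList (om b)))
    (hrule : ∀ l x t, (l, x, t) ∈ S →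
      stackValue (PresentedMonoid.of P.Rel) ω (l ++ [(x, 1)]) = ω t)
    (hrel : ∀ u : List P.Alphabet, spell u ∈ P.2 → (u.map (letterAction S)).prod = 1)
    (hom : ∀ b, scaleAction P.Alphabet Q.Semigrp (PresentedMonoid.of Q.Rel b) =
      ((om b).map (letterAction S)).prod) :
    Function.Injective ω ∧ ∀ u : P.Semigrp, IsUnit u → ∃ t, ω t = u := by
  let A : P.Semigrp →* (Function.End (Q.Semigrp × List (P.Alphabet × Q.Semigrp)))ᵐᵒᵖ :=
    PresentedMonoid.lift (letterAction S) (by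
      rintro a b ⟨h, rfl⟩
      rw [FreeMonoid.lift_apply, map_one]
      exact hrel _ h)
  have hA : ∀ x, A (PresentedMonoid.of P.Rel x) = letterAction S x := fun _ => rfl
  have hAω : A.comp ω = scaleAction P.Alphabet Q.Semigrp := by
    apply PresentedMonoid.ext
    intro b
    rw [MonoidHom.comp_apply, hω, hom, mk_ofList, map_list_prod, List.map_map]
    rfl
  exact injective_and_units_of_nonOverlapping hS (PresentedMonoid.of P.Rel) ω
    (PresentedMonoid.closure_range_of _) hrule A hA fun t => DFunLike.congr_fun hAω t

/-- The generators of `Q` are the values of the pieces of the relators. The rules and the words `om`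
are kept because the certificate is later assembled from them. -/
theorem exists_units_rules (hP : IsKLSemigroup k ℓ P) :
    ∃ Q, IsKLGroup k ℓ Q ∧ ∃ (ω : Q.Semigrp →* P.Semigrp)
      (rules : List (List (P.Alphabet × Q.Semigrp) × P.Alphabet × Q.Semigrp))
      (om : Q.Alphabet → List P.Alphabet),
      NonOverlapping {r | r ∈ rules} ∧
      (∀ b, ω (PresentedMonoid.of Q.Rel b) =
        PresentedMonoid.mk P.Rel (FreeMonoid.ofList (om b))) ∧
      (∀ r ∈ rules, stackValue (PresentedMonoid.of P.Rel) ω (r.1 ++ [(r.2.1, 1)]) = ω r.2.2) ∧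
      ∀ (K : Type) [Monoid K] (α : P.Alphabet → K) (β : Q.Semigrp →* K),
        (∀ r ∈ rules, stackValue α β (r.1 ++ [(r.2.1, 1)]) = β r.2.2) →
        (∀ u : List P.Alphabet, spell u ∈ P.2 → (u.map α).prod = 1) ∧
        ∀ b, β (PresentedMonoid.of Q.Rel b) = ((om b).map α).prod := by
  classical
  let χ := PresentedMonoid.of P.Rel
  let val : List P.Alphabet → P.Semigrp := fun w => (w.map χ).prod
  obtain ⟨us, hus⟩ : ∃ us : List (List P.Alphabet), us.map spell = P.2 := by
    have : ∀ L : List (List ℕ), (∀ A ∈ L, ∀ a ∈ A, a < P.1) →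
        ∃ us : List (List P.Alphabet), us.map spell = L := by
      intro L
      induction L with
      | nil => exact fun _ => ⟨[], rfl⟩
      | cons A L ih =>
        intro h
        obtain ⟨us, rfl⟩ := ih fun B hB => h B (List.mem_cons_of_mem _ hB)
        obtain ⟨u, rfl⟩ := exists_spell (h A List.mem_cons_self)
        exact ⟨u :: us, rfl⟩
    exact this P.2 fun A hA => (hP.2 A hA).2
  have hval : ∀ u ∈ us, val u = 1 := fun u hu => by
    have := mk_relator (P := P) (u := u) (hus ▸ List.mem_map_of_mem hu)
    rwa [mk_ofList] at this
  have hex : ∀ u, ∃ ws : List (List P.Alphabet), IsUnit (val u) → ws.flatten = u ∧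
      ∀ w ∈ ws, w ≠ [] ∧ IsUnit (w.map χ).prod ∧
      ∀ a b, w = a ++ b → a ≠ [] → b ≠ [] → ¬ IsUnit (a.map χ).prod := by
    intro u
    by_cases h : IsUnit (val u)
    · obtain ⟨ws, hws⟩ := exists_minimal_unit_factorization χ u h
      exact ⟨ws, fun _ => hws⟩
    · exact ⟨[], fun h' => absurd h' h⟩
  choose pc hpc using hex
  replace hpc : ∀ u ∈ us, _ := fun u hu => hpc u (hval u hu ▸ isUnit_one)
  let D := us.flatMap pc
  have hD : ∀ w ∈ D, w ≠ [] ∧ IsUnit (w.map χ).prod ∧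
      ∀ a b, w = a ++ b → a ≠ [] → b ≠ [] → ¬ IsUnit (a.map χ).prod := by
    intro w hw
    obtain ⟨u, hu, hw⟩ := List.mem_flatMap.1 hw
    exact (hpc u hu).2 w hw
  -- One generator per value, not per piece: thus pieces with equal values have the same image under
  -- `φ`.
  let Vs := (D.map val).dedup
  have hVs : ∀ w ∈ D, Vs.idxOf (val w) < Vs.length := fun w hw =>
    List.idxOf_lt_length_iff.2 (List.mem_dedup.2 (List.mem_map_of_mem hw))
  let Q : SpecialPresentation := (Vs.length, us.map fun u => (pc u).map fun w => Vs.idxOf (val w))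
  let φ : List P.Alphabet → Q.Semigrp := fun w => Q.letterClass (Vs.idxOf (val w))
  have hQ : IsKLSemigroup k ℓ Q := by
    refine ⟨?_, ?_⟩
    · rw [← hP.1, ← hus]
      simp [Q]
    · intro A hA
      obtain ⟨u, hu, rfl⟩ := List.mem_map.1 hA
      -- Pieces are nonempty, so a relator has at most as many pieces as letters; this preserves the
      -- bound `ℓ`.
      have hlen : ∀ ws : List (List P.Alphabet), (∀ w ∈ ws, w ≠ []) →
          ws.length ≤ ws.flatten.length := by
        intro ws
        induction ws with
        | nil => simp
        | cons w ws ih =>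
          intro h
          have h1 := ih fun w hw => h w (List.mem_cons_of_mem _ hw)
          have h2 := List.length_pos_iff.2 (h w List.mem_cons_self)
          simp only [List.length_cons, List.flatten_cons, List.length_append]
          omega
      refine ⟨?_, ?_⟩
      · have h1 := hlen (pc u) fun w hw => ((hpc u hu).2 w hw).1
        have h2 := (hP.2 (spell u) (hus ▸ List.mem_map_of_mem hu)).1
        rw [(hpc u hu).1] at h1
        simp only [spell, List.length_map] at h2 ⊢
        omega
      · intro a ha
        obtain ⟨w, hw, rfl⟩ := List.mem_map.1 ha
        exact hVs w (List.mem_flatMap.2 ⟨u, hu, hw⟩)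
  have hflat : ∀ (K : Type) [Monoid K] (α : P.Alphabet → K), ∀ u ∈ us,
      (u.map α).prod = ((pc u).map fun w => (w.map α).prod).prod := by
    intro K _ α u hu
    conv_lhs => rw [← (hpc u hu).1]
    rw [List.map_flatten, List.prod_flatten, List.map_map]
    rfl
  let ω : Q.Semigrp →* P.Semigrp := PresentedMonoid.lift (fun b : Fin Vs.length => Vs[b]) (by
    rintro a b ⟨h, rfl⟩
    obtain ⟨u, hu, he⟩ := List.mem_map.1 h
    rw [FreeMonoid.lift_apply, map_one, ← hval u hu]
    refine Eq.trans ?_ (hflat _ χ u hu).symm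
    have h1 : a.toList.map (fun b : Fin Vs.length => Vs[b]) =
        (spell (P := Q) a.toList).map fun i => Vs.getD i 1 := by
      rw [spell, List.map_map]
      refine List.map_congr_left fun b _ => ?_
      exact (List.getD_eq_getElem Vs 1 b.2).symm
    have h2 : List.map (fun b : Fin Vs.length => Vs[b]) a.toList = (pc u).map val := by
      rw [h1, ← he, List.map_map]
      refine List.map_congr_left fun w hw => ?_
      have := hVs w (List.mem_flatMap.2 ⟨u, hu, hw⟩)
      rw [Function.comp_apply, List.getD_eq_getElem _ _ this, List.getElem_idxOf this]
    exact congrArg List.prod h2)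
  have hωof : ∀ b : Q.Alphabet, ω (PresentedMonoid.of Q.Rel b) = Vs[b.1]'b.2 := fun _ => rfl
  have hωφ : ∀ w ∈ D, (w.map χ).prod = ω (φ w) := by
    intro w hw
    have := hVs w hw
    have e : φ w = PresentedMonoid.of Q.Rel ⟨_, this⟩ := by
      simp only [φ, letterClass]
      exact dif_pos this
    rw [e, hωof, List.getElem_idxOf this]
  have hVmem : ∀ b : Q.Alphabet, ∃ w ∈ D, val w = Vs[b.1]'b.2 := fun b =>
    List.mem_map.1 (List.mem_dedup.1 (List.getElem_mem b.2))
  choose om homD homV using hVmem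
  have hunit : ∀ t, IsUnit (ω t) := by
    refine isUnit_of_forall_of ω fun b => ?_
    rw [hωof, ← homV]
    exact (hD _ (homD b)).2.1
  have hφ : ∀ w ∈ D.toFinset, ∀ w' ∈ D.toFinset, ω (φ w) = ω (φ w') → φ w = φ w' := by
    intro w hw w' hw' h
    rw [← hωφ w (List.mem_toFinset.1 hw), ← hωφ w' (List.mem_toFinset.1 hw')] at h
    simp only [φ, val, h]
  obtain ⟨rules, hno, hrule, hgen⟩ := exists_nonOverlapping_rules hunit hφ
    (fun w hw => hωφ w (List.mem_toFinset.1 hw)) (fun h => (hD _ (List.mem_toFinset.1 h)).1 rfl)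
    (fun a b h => (hD _ (List.mem_toFinset.1 h)).2.2 a b rfl)
  have hK : ∀ (K : Type) [Monoid K] (α : P.Alphabet → K) (β : Q.Semigrp →* K),
        (∀ r ∈ rules, stackValue α β (r.1 ++ [(r.2.1, 1)]) = β r.2.2) →
        (∀ u : List P.Alphabet, spell u ∈ P.2 → (u.map α).prod = 1) ∧
        ∀ b, β (PresentedMonoid.of Q.Rel b) = ((om b).map α).prod := by
    intro K _ α β h
    have hα := hgen K α β h
    refine ⟨fun u hu => ?_, fun b => ?_⟩
    · have hu' : u ∈ us := by
        rw [← hus] at hu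
        obtain ⟨u', hu', e⟩ := List.mem_map.1 hu
        rwa [← spell_injective e]
      rw [hflat K α u hu']
      have h1 : ((pc u).map fun w => (w.map α).prod) = ((pc u).map φ).map β := by
        rw [List.map_map]
        exact List.map_congr_left fun w hw =>
          hα w (List.mem_toFinset.2 (List.mem_flatMap.2 ⟨u, hu', hw⟩))
      rw [h1, ← map_list_prod, ← map_one β]
      congr 1
      have h2 := wordClass_relator hQ
        (A := (pc u).map fun w => Vs.idxOf (val w)) (List.mem_map_of_mem hu')
      rwa [wordClass, List.map_map] at h2
    · rw [hα (om b) (List.mem_toFinset.2 (homD b))]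
      congr 1
      simp only [φ]
      rw [homV, List.Nodup.idxOf_getElem (List.nodup_dedup _), letterClass_val]
  have hωom : ∀ b, ω (PresentedMonoid.of Q.Rel b) =
      PresentedMonoid.mk P.Rel (FreeMonoid.ofList (om b)) := by
    intro b
    rw [mk_ofList, hωof, ← homV]
  -- The rules hold for the action on stacks, hence so do the relators of `P` and the expressions
  -- `om` of the generators.
  have hact := hK _ (letterAction {r | r ∈ rules}) (scaleAction P.Alphabet Q.Semigrp)
    fun r hr => stackValue_action_of_mem hno hr
  obtain ⟨hinj, hsurj⟩ := injective_and_units_of_rules hno ω om hωom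
    (fun l x t h => hrule _ h) hact.1 hact.2
  refine ⟨Q, ⟨hQ, fun t => ?_⟩, ω, rules, om, hno, hωom, hrule, hK⟩
  obtain ⟨m, hm⟩ := hunit t
  -- The inverse of `ω t` is in the image, and injectivity pulls it back to an inverse of `t`.
  obtain ⟨t', ht'⟩ := hsurj ((m⁻¹ : P.Semigrpˣ) : P.Semigrp) (Units.isUnit _)
  refine isUnit_iff_exists_and_exists.2 ⟨⟨t', hinj ?_⟩, ⟨t', hinj ?_⟩⟩
  · rw [map_mul, map_one, ht', ← hm, Units.mul_inv]
  · rw [map_mul, map_one, ht', ← hm, Units.inv_mul]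

end SpecialPresentation

/-! ### Finite certificates for the group of units -/

namespace SpecialPresentation

/-- The congruence on raw words generated by a finite list of rules. -/
def RawEq (R : List (List ℕ × List ℕ)) (u v : List ℕ) : Prop :=
  conGen (fun a b : FreeMonoid ℕ => (a.toList, b.toList) ∈ R) (FreeMonoid.ofList u)
    (FreeMonoid.ofList v)

theorem RawEq.map_prod_eq {R : List (List ℕ × List ℕ)} {u v : List ℕ} (h : RawEq R u v)
    {K : Type*} [Monoid K] (f : ℕ → K) (hf : ∀ r ∈ R, (r.1.map f).prod = (r.2.map f).prod) :
    (u.map f).prod = (v.map f).prod := by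
  have : conGen (fun a b : FreeMonoid ℕ => (a.toList, b.toList) ∈ R) ≤
      Con.ker (FreeMonoid.lift f) := by
    rw [Con.conGen_le]
    intro a b hab
    rw [Con.ker_apply, FreeMonoid.lift_apply, FreeMonoid.lift_apply]
    exact hf _ hab
  have := this h
  rwa [Con.ker_apply, FreeMonoid.lift_apply, FreeMonoid.lift_apply] at this

/-- Test the hypothesis on the quotient by the congruence itself. Derivability may thus be proved by
checking all models of the rules. -/
theorem rawEq_of_forall {R : List (List ℕ × List ℕ)} {u v : List ℕ}
    (h : ∀ (K : Type) [Monoid K] (f : ℕ → K), (∀ r ∈ R, (r.1.map f).prod = (r.2.map f).prod) →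
      (u.map f).prod = (v.map f).prod) : RawEq R u v := by
  let C := conGen fun a b : FreeMonoid ℕ => (a.toList, b.toList) ∈ R
  have hC : ∀ w : List ℕ, (w.map fun a => ((FreeMonoid.of a : FreeMonoid ℕ) : C.Quotient)).prod =
      ((FreeMonoid.ofList w : FreeMonoid ℕ) : C.Quotient) := by
    intro w
    induction w with
    | nil => rfl
    | cons a w ih => rw [List.map_cons, List.prod_cons, ih]; rfl
  have := h C.Quotient (fun a => ((FreeMonoid.of a : FreeMonoid ℕ) : C.Quotient)) (by
    intro r hr
    rw [hC, hC, Con.eq]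
    exact ConGen.Rel.of _ _ hr)
  rwa [hC, hC, Con.eq] at this

/-- The defining relations of a special presentation as rules. -/
def relRules (P : SpecialPresentation) : List (List ℕ × List ℕ) := P.2.map fun A => (A, [])

/-- A rule of a pattern system with the monoid elements given by raw words. -/
abbrev RawRule : Type := List (ℕ × List ℕ) × ℕ × List ℕ

/-- The left-hand side of a raw rule as a word, where `2 x` stands for the letter `x` of the
semigroup, and `2 b + 1` for the letter `b` of the group. -/
def ruleWord (r : RawRule) : List ℕ :=
  2 * r.2.1 :: r.1.reverse.flatMap fun p => p.2.map (fun b => 2 * b + 1) ++ [2 * p.1]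

/-- The presentation that is defined by the relations of `Q` and by raw rules. -/
def combinedRules (Q : SpecialPresentation) (rules : List RawRule) : List (List ℕ × List ℕ) :=
  Q.2.map (fun A => (A.map fun b => 2 * b + 1, [])) ++
    rules.map fun r => (ruleWord r, r.2.2.map fun b => 2 * b + 1)

/-- Replace the letters of the group by the words `om` over the letters of the semigroup. -/
def substLetter (om : List (List ℕ)) (n : ℕ) : List ℕ :=
  if n % 2 = 0 then [n / 2] else om.getD (n / 2) []

/-- The letters of the left-hand side of a raw rule. -/
def ruleLetters (r : RawRule) : List ℕ := r.1.map Prod.fst ++ [r.2.1]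

/-- The rules `r` without its first `j` letters and `r'` differ at some place. -/
def RulesClash (ne : List ℕ → List ℕ → Prop) (r r' : RawRule) (j : ℕ) : Prop :=
  ∃ i, (i + j ≤ r.1.length ∧ i ≤ r'.1.length) ∧
    ((ruleLetters r)[i + j]? ≠ (ruleLetters r')[i]? ∨
      ((i + j < r.1.length ∧ i < r'.1.length) ∧
        ne ((r.1.map Prod.snd).getD (i + j) []) ((r'.1.map Prod.snd).getD i [])))

/-- The letters of a raw rule belong to the alphabets of `P` and `Q`. -/
def ValidRule (P Q : SpecialPresentation) (r : RawRule) : Prop :=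
  r.2.1 < P.1 ∧ (∀ b ∈ r.2.2, b < Q.1) ∧ ∀ p ∈ r.1, p.1 < P.1 ∧ ∀ b ∈ p.2, b < Q.1

/-- A certificate that the group presented by `Q` is isomorphic to the group of units of the
semigroup presented by `P`. -/
structure UnitsCertificate (k ℓ : ℕ) (P Q : SpecialPresentation) (ne : List ℕ → List ℕ → Prop)
    (rules : List RawRule) (om : List (List ℕ)) : Prop where
  isKLSemigroup : IsKLSemigroup k ℓ Q
  inverses : ∀ b < Q.1, ∃ v : List ℕ × List ℕ,
    RawEq (relRules Q) (b :: v.1) [] ∧ RawEq (relRules Q) (v.2 ++ [b]) []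
  valid : ∀ r ∈ rules, ValidRule P Q r
  om_valid : ∀ w ∈ om, ∀ a ∈ w, a < P.1
  combined : ∀ r ∈ combinedRules Q rules,
    RawEq (relRules P) (r.1.flatMap (substLetter om)) (r.2.flatMap (substLetter om))
  relators : ∀ A ∈ P.2, RawEq (combinedRules Q rules) (A.map fun a => 2 * a) []
  letters : ∀ b < Q.1,
    RawEq (combinedRules Q rules) [2 * b + 1] ((om.getD b []).map fun a => 2 * a)
  clash : ∀ r ∈ rules, ∀ r' ∈ rules, ∀ j < r.1.length + 1, RulesClash ne r r' j ∨
    ((j = 0 ∧ r.1.length = r'.1.length) ∧ RawEq (relRules Q) r.2.2 r'.2.2)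

variable {P Q : SpecialPresentation} {k ℓ : ℕ} {rules : List RawRule} {om : List (List ℕ)}
  {ne : List ℕ → List ℕ → Prop}

theorem RawEq.wordClass_eq (hP : IsKLSemigroup k ℓ P) {u v : List ℕ}
    (h : RawEq (relRules P) u v) : P.wordClass u = P.wordClass v := by
  refine h.map_prod_eq _ fun r hr => ?_
  obtain ⟨A, hA, rfl⟩ := List.mem_map.1 hr
  exact wordClass_relator hP hA

theorem exists_hom_of_relRules {K : Type*} [Monoid K] (f : ℕ → K)
    (hf : ∀ r ∈ relRules P, (r.1.map f).prod = (r.2.map f).prod) :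
    ∃ γ : P.Semigrp →* K, ∀ a : P.Alphabet, γ (PresentedMonoid.of P.Rel a) = f a.1 := by
  refine ⟨PresentedMonoid.lift (fun a => f a.1) ?_, fun a => rfl⟩
  rintro u v ⟨h, rfl⟩
  have := hf _ (List.mem_map_of_mem h)
  simpa [FreeMonoid.lift_apply, spell, Function.comp_def] using this

/-- The bounds on letters are needed: `letterClass` sends a foreign letter to `1`, while `RawEq`
leaves it free. -/
theorem rawEq_of_wordClass_eq {u v : List ℕ} (hu : ∀ a ∈ u, a < P.1) (hv : ∀ a ∈ v, a < P.1)
    (h : P.wordClass u = P.wordClass v) : RawEq (relRules P) u v := by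
  refine rawEq_of_forall fun K _ f hf => ?_
  obtain ⟨γ, hγ⟩ := exists_hom_of_relRules f hf
  have key : ∀ w : List ℕ, (∀ a ∈ w, a < P.1) → (w.map f).prod = γ (P.wordClass w) := by
    intro w hw
    rw [wordClass, map_list_prod, List.map_map]
    congr 1
    refine List.map_congr_left fun a ha => ?_
    rw [Function.comp_apply, ← hγ ⟨a, hw a ha⟩, ← letterClass_val]
  rw [key u hu, key v hv, h]

/-- The raw rule `r` spells the rule `(l, x, t)`. -/
def Spells (r : RawRule) (l : List (P.Alphabet × Q.Semigrp)) (x : P.Alphabet) (t : Q.Semigrp) :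
    Prop :=
  l.map (fun p => (p.1.1, p.2)) = r.1.map (fun p => (p.1, Q.wordClass p.2)) ∧ x.1 = r.2.1 ∧
    t = Q.wordClass r.2.2

theorem ValidRule.exists_spells {r : RawRule} (hr : ValidRule P Q r) :
    ∃ (l : List (P.Alphabet × Q.Semigrp)) (x : P.Alphabet), Spells r l x (Q.wordClass r.2.2) := by
  obtain ⟨l, x, t⟩ := r
  obtain ⟨hx, -, hl⟩ := hr
  have : ∃ l' : List (P.Alphabet × Q.Semigrp),
      l'.map (fun p => (p.1.1, p.2)) = l.map (fun p => (p.1, Q.wordClass p.2)) := by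
    clear hx
    induction l with
    | nil => exact ⟨[], rfl⟩
    | cons p l ih =>
      obtain ⟨l', h'⟩ := ih fun q hq => hl q (List.mem_cons_of_mem _ hq)
      exact ⟨(⟨p.1, (hl p List.mem_cons_self).1⟩, Q.wordClass p.2) :: l', by simp [h']⟩
  obtain ⟨l', h'⟩ := this
  exact ⟨l', ⟨x, hx⟩, h', rfl, rfl⟩

theorem prod_map_odd {K : Type*} [Monoid K] (β : Q.Semigrp →* K) (nu : ℕ → K)
    (hβ : ∀ b < Q.1, nu (2 * b + 1) = β (Q.letterClass b)) {t : List ℕ} (ht : ∀ b ∈ t, b < Q.1) :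
    ((t.map fun b => 2 * b + 1).map nu).prod = β (Q.wordClass t) := by
  rw [wordClass, map_list_prod, List.map_map, List.map_map]
  congr 1
  exact List.map_congr_left fun b hb => hβ b (ht b hb)

theorem prod_map_ruleWord {K : Type*} [Monoid K] (α : P.Alphabet → K) (β : Q.Semigrp →* K)
    (nu : ℕ → K) (hα : ∀ x : P.Alphabet, nu (2 * x.1) = α x)
    (hβ : ∀ b < Q.1, nu (2 * b + 1) = β (Q.letterClass b)) {r : RawRule} (hr : ValidRule P Q r)
    {l : List (P.Alphabet × Q.Semigrp)} {x : P.Alphabet} {t : Q.Semigrp} (h : Spells r l x t) :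
    ((ruleWord r).map nu).prod = stackValue α β (l ++ [(x, 1)]) := by
  obtain ⟨l', x', t'⟩ := r
  obtain ⟨h1, h2, -⟩ := h
  obtain ⟨-, -, hl⟩ := hr
  simp only at h1 h2 hl
  subst h2
  have : (((l'.reverse.flatMap fun p => p.2.map (fun b => 2 * b + 1) ++ [2 * p.1])).map nu).prod =
      stackValue α β l := by
    induction l' generalizing l with
    | nil =>
      rw [List.map_nil, List.map_eq_nil_iff] at h1
      subst h1
      rfl
    | cons p l' ih =>
      cases l with
      | nil => simp at h1
      | cons q l =>
        simp only [List.map_cons, List.cons.injEq, Prod.mk.injEq] at h1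
        obtain ⟨⟨h1, h2⟩, h3⟩ := h1
        rw [List.reverse_cons, List.flatMap_append, List.map_append, List.prod_append,
          ih h3 fun p hp => hl p (List.mem_cons_of_mem _ hp)]
        simp only [List.flatMap_singleton, List.map_append, List.prod_append, stackValue]
        rw [prod_map_odd β nu hβ (hl p List.mem_cons_self).2, h2, ← h1, mul_assoc]
        simp [hα]
  rw [ruleWord, List.map_cons, List.prod_cons, this, stackValue_append, hα]
  simp [stackValue]

/-- Together with `stackValue_eq_of_combinedRules` this identifies models of the combined
presentation with pairs `α`, `β` that satisfy the rules. -/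
theorem combinedRules_prod_eq {K : Type*} [Monoid K] (hQ : IsKLSemigroup k ℓ Q)
    (hrules : ∀ r ∈ rules, ValidRule P Q r) (α : P.Alphabet → K) (β : Q.Semigrp →* K)
    (nu : ℕ → K) (hα : ∀ x : P.Alphabet, nu (2 * x.1) = α x)
    (hβ : ∀ b < Q.1, nu (2 * b + 1) = β (Q.letterClass b))
    (h : ∀ r ∈ rules, ∃ l x t, Spells r l x t ∧ stackValue α β (l ++ [(x, 1)]) = β t) :
    ∀ r ∈ combinedRules Q rules, (r.1.map nu).prod = (r.2.map nu).prod := by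
  intro r hr
  rcases List.mem_append.1 hr with hr | hr
  · obtain ⟨A, hA, rfl⟩ := List.mem_map.1 hr
    simp only
    rw [prod_map_odd β nu hβ (hQ.2 A hA).2, wordClass_relator hQ hA]
    simp
  · obtain ⟨r, hr₁, rfl⟩ := List.mem_map.1 hr
    obtain ⟨l, x, t, hs, e⟩ := h r hr₁
    simp only
    rw [prod_map_odd β nu hβ (hrules r hr₁).2.1, prod_map_ruleWord α β nu hα hβ (hrules r hr₁) hs,
      e, hs.2.2]

theorem stackValue_eq_of_combinedRules {K : Type*} [Monoid K]
    (hrules : ∀ r ∈ rules, ValidRule P Q r) (α : P.Alphabet → K) (β : Q.Semigrp →* K)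
    (nu : ℕ → K) (hα : ∀ x : P.Alphabet, nu (2 * x.1) = α x)
    (hβ : ∀ b < Q.1, nu (2 * b + 1) = β (Q.letterClass b))
    (h : ∀ r ∈ combinedRules Q rules, (r.1.map nu).prod = (r.2.map nu).prod)
    {r : RawRule} (hr : r ∈ rules) {l : List (P.Alphabet × Q.Semigrp)} {x : P.Alphabet}
    {t : Q.Semigrp} (hs : Spells r l x t) : stackValue α β (l ++ [(x, 1)]) = β t := by
  rw [← prod_map_ruleWord α β nu hα hβ (hrules r hr) hs, hs.2.2,
    ← prod_map_odd β nu hβ (hrules r hr).2.1]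
  exact h _ (List.mem_append_right _ (List.mem_map_of_mem hr))

theorem prod_map_flatMap {K : Type*} [Monoid K] (f : ℕ → K) (g : ℕ → List ℕ) (w : List ℕ) :
    ((w.flatMap g).map f).prod = (w.map fun n => ((g n).map f).prod).prod := by
  induction w with
  | nil => rfl
  | cons a w ih => simp [ih]

theorem substLetter_even (x : ℕ) : substLetter om (2 * x) = [x] := by
  simp [substLetter]

theorem substLetter_odd (b : ℕ) : substLetter om (2 * b + 1) = om.getD b [] := by
  have h1 : (2 * b + 1) % 2 = 1 := by omega
  have h2 : (2 * b + 1) / 2 = b := by omega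
  simp [substLetter, h1, h2]

theorem Spells.ruleLetters_eq {r : RawRule} {l : List (P.Alphabet × Q.Semigrp)} {x : P.Alphabet}
    {t : Q.Semigrp} (hs : Spells r l x t) (g : Q.Semigrp) :
    ruleLetters r = (l ++ [(x, g)]).map fun p => p.1.1 := by
  have := congrArg (List.map Prod.fst) hs.1
  simp only [List.map_map, Function.comp_def] at this
  simp [ruleLetters, this, hs.2.1]

theorem Spells.length_eq {r : RawRule} {l : List (P.Alphabet × Q.Semigrp)} {x : P.Alphabet}
    {t : Q.Semigrp} (hs : Spells r l x t) : r.1.length = l.length := by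
  simpa using (congrArg List.length hs.1).symm

theorem Spells.wordClass_getD {r : RawRule} {l : List (P.Alphabet × Q.Semigrp)} {x : P.Alphabet}
    {t : Q.Semigrp} (hs : Spells r l x t) {i : ℕ} (hi : i < l.length) :
    Q.wordClass ((r.1.map Prod.snd).getD i []) = l[i].2 := by
  have hi' : i < r.1.length := hs.length_eq ▸ hi
  have h1 := congrArg (fun L => L[i]?) hs.1
  simp only [List.getElem?_map, List.getElem?_eq_getElem hi, List.getElem?_eq_getElem hi',
    Option.map_some, Option.some.injEq, Prod.mk.injEq] at h1
  rw [List.getD_eq_getElem _ _ (by simpa using hi'), List.getElem_map, ← h1.2]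

/-- Soundness. `inverses` comes first, since `ne` is trusted only once `Q` is known to be a group.
Then `clash` excludes overlaps, `combined` provides `ω` and the rules in the semigroup of `P`, and
`relators` and `letters` make that semigroup act on stacks. -/
theorem UnitsCertificate.isKLGroupOfUnits (hP : IsKLSemigroup k ℓ P)
    (hc : UnitsCertificate k ℓ P Q ne rules om)
    (hne : IsKLGroup k ℓ Q → ∀ u v, (∀ b ∈ u, b < Q.1) → (∀ b ∈ v, b < Q.1) → ne u v →
      Q.wordClass u ≠ Q.wordClass v) : IsKLGroupOfUnits k ℓ P Q := by
  have hQ := hc.isKLSemigroup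
  have hgroup : ∀ t : Q.Semigrp, IsUnit t := by
    refine isUnit_of_forall_of (MonoidHom.id _) fun b => ?_
    obtain ⟨v, h1, h2⟩ := hc.inverses b b.2
    have h1 := h1.wordClass_eq hQ
    have h2 := h2.wordClass_eq hQ
    simp only [wordClass, List.map_cons, List.map_append, List.prod_cons, List.prod_append,
      letterClass_val, List.map_nil, List.prod_nil, mul_one] at h1 h2
    exact isUnit_iff_exists_and_exists.2 ⟨⟨_, h1⟩, ⟨_, h2⟩⟩
  replace hne := hne ⟨hQ, hgroup⟩
  let S : Set (List (P.Alphabet × Q.Semigrp) × P.Alphabet × Q.Semigrp) :=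
    {s | ∃ r ∈ rules, Spells r s.1 s.2.1 s.2.2}
  have hS : NonOverlapping S := by
    rintro L t L' t' c o ⟨l, x, g, s, ⟨r, hr, hs : Spells r l x s⟩, rfl, rfl⟩
      ⟨l', x', g', s', ⟨r', hr', hs' : Spells r' l' x' s'⟩, rfl, rfl⟩ hco ho hpfx
    have hlen := congrArg List.length hco
    simp only [List.length_append, List.length_cons, List.length_nil] at hlen
    have hopos := List.length_pos_iff.2 ho
    have hget : ∀ i, i < o.length → i < (l' ++ [(x', g')]).length →
        o[i]? = (l' ++ [(x', g')])[i]? := by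
      intro i h1 h2
      rcases hpfx with ⟨d, hd⟩ | ⟨d, hd⟩
      · rw [← hd, List.getElem?_append_left h1]
      · rw [← hd, List.getElem?_append_left h2]
    have hget' : ∀ i, i < o.length → i < (l' ++ [(x', g')]).length →
        (l ++ [(x, g)])[i + c.length]? = (l' ++ [(x', g')])[i]? := by
      intro i h1 h2
      rw [← hget i h1 h2, hco, List.getElem?_append_right (by omega), Nat.add_sub_cancel]
    -- The part `c` lies above the overlap, so its length is the shift. Coefficients are compared
    -- only where neither rule is at its bottom, where the coefficient is free.
    rcases hc.clash r hr r' hr' c.length (by rw [hs.length_eq]; omega) with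
      ⟨i, ⟨h1, h2⟩, h3⟩ | ⟨⟨h1, h2⟩, h3⟩
    · exfalso
      rw [hs.length_eq] at h1 h3
      rw [hs'.length_eq] at h2 h3
      have h4 := hget' i (by omega) (by simp; omega)
      rcases h3 with h3 | ⟨⟨h5, h6⟩, h3⟩
      · refine h3 ?_
        rw [hs.ruleLetters_eq g, hs'.ruleLetters_eq g', List.getElem?_map, List.getElem?_map, h4]
      · refine hne _ _ ?_ ?_ h3 ?_
        · have h7 : i + c.length < (r.1.map Prod.snd).length := by simpa [hs.length_eq] using h5
          rw [List.getD_eq_getElem _ _ h7]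
          obtain ⟨p, hp, e⟩ := List.mem_map.1 (List.getElem_mem h7)
          rw [← e]
          exact ((hc.valid r hr).2.2 p hp).2
        · have h7 : i < (r'.1.map Prod.snd).length := by simpa [hs'.length_eq] using h6
          rw [List.getD_eq_getElem _ _ h7]
          obtain ⟨p, hp, e⟩ := List.mem_map.1 (List.getElem_mem h7)
          rw [← e]
          exact ((hc.valid r' hr').2.2 p hp).2
        · rw [hs.wordClass_getD h5, hs'.wordClass_getD h6]
          rw [List.getElem?_append_left h5, List.getElem?_append_left h6,
            List.getElem?_eq_getElem h5, List.getElem?_eq_getElem h6, Option.some.injEq] at h4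
          rw [h4]
    · have hcn : c = [] := List.length_eq_zero_iff.1 h1
      subst hcn
      rw [hs.length_eq, hs'.length_eq] at h2
      have hoL : o = l' ++ [(x', g')] := by
        rcases hpfx with h | h
        · exact h.eq_of_length (by simp at hlen ⊢; omega)
        · exact (h.eq_of_length (by simp at hlen ⊢; omega)).symm
      refine ⟨rfl, hoL, ?_⟩
      rw [List.nil_append, hoL] at hco
      obtain ⟨-, h4⟩ := List.append_inj' hco rfl
      simp only [List.cons.injEq, Prod.mk.injEq, and_true] at h4
      rw [h4.2, hs.2.2, hs'.2.2, h3.wordClass_eq hQ]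
  have hspells : ∀ r ∈ rules, ∃ l x, Spells (P := P) (Q := Q) r l x (Q.wordClass r.2.2) :=
    fun r hr => (hc.valid r hr).exists_spells
  have hom : ∀ b : Q.Alphabet, ∃ w : List P.Alphabet, spell w = om.getD b [] := by
    intro b
    refine exists_spell ?_
    rcases lt_or_ge b.1 om.length with h | h
    · rw [List.getD_eq_getElem _ _ h]
      exact hc.om_valid _ (List.getElem_mem h)
    · rw [List.getD_eq_default _ _ h]
      simp
  choose w hw using hom
  have hsubst : ∀ r ∈ combinedRules Q rules,
      (r.1.map fun n => P.wordClass (substLetter om n)).prod =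
        (r.2.map fun n => P.wordClass (substLetter om n)).prod := by
    intro r hr
    have := (hc.combined r hr).wordClass_eq hP
    rwa [wordClass, wordClass, prod_map_flatMap, prod_map_flatMap] at this
  let ω : Q.Semigrp →* P.Semigrp := PresentedMonoid.lift
    (fun b : Q.Alphabet => P.wordClass (om.getD b [])) (by
      rintro u v ⟨h, rfl⟩
      have h1 := hsubst (_, _) (List.mem_append_left _ (List.mem_map_of_mem h))
      simp only [spell, List.map_map, List.map_nil] at h1
      rw [FreeMonoid.lift_apply, map_one]
      refine Eq.trans (congrArg List.prod ?_) h1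
      exact List.map_congr_left fun b _ => by
        rw [Function.comp_apply, Function.comp_apply, substLetter_odd])
  have hω : ∀ b, ω (PresentedMonoid.of Q.Rel b) = P.wordClass (om.getD b []) := fun b => rfl
  have hrule : ∀ l x t, (l, x, t) ∈ S →
      stackValue (PresentedMonoid.of P.Rel) ω (l ++ [(x, 1)]) = ω t := by
    rintro l x t ⟨r, hr, hs⟩
    refine stackValue_eq_of_combinedRules hc.valid _ ω _ ?_ ?_ hsubst hr hs
    · intro x
      rw [substLetter_even, wordClass, List.map_singleton, List.prod_singleton, letterClass_val]
    · intro b hb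
      rw [substLetter_odd, show b = (⟨b, hb⟩ : Q.Alphabet).1 from rfl, letterClass_val, hω]
  -- Even letters push, odd letters scale: a model of the combined presentation on stacks.
  let nu : ℕ → (Function.End (Q.Semigrp × List (P.Alphabet × Q.Semigrp)))ᵐᵒᵖ := fun n =>
    if n % 2 = 0 then if h : n / 2 < P.1 then letterAction S ⟨n / 2, h⟩ else 1
    else scaleAction P.Alphabet Q.Semigrp (Q.letterClass (n / 2))
  have hnu₀ : ∀ x : P.Alphabet, nu (2 * x.1) = letterAction S x := by
    intro x
    simp [nu]
  have hnu₁ : ∀ b, nu (2 * b + 1) = scaleAction P.Alphabet Q.Semigrp (Q.letterClass b) := by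
    intro b
    have h1 : (2 * b + 1) % 2 = 1 := by omega
    have h2 : (2 * b + 1) / 2 = b := by omega
    simp [nu, h1, h2]
  have hcomb := combinedRules_prod_eq hQ hc.valid (letterAction S)
    (scaleAction P.Alphabet Q.Semigrp) nu hnu₀ (fun b _ => hnu₁ b) fun r hr => by
      obtain ⟨l, x, hs⟩ := hspells r hr
      exact ⟨l, x, _, hs, stackValue_action_of_mem hS ⟨r, hr, hs⟩⟩
  have heven : ∀ u : List P.Alphabet,
      (((spell u).map fun a => 2 * a).map nu).prod = (u.map (letterAction S)).prod := by
    intro u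
    rw [spell, List.map_map, List.map_map]
    congr 1
    exact List.map_congr_left fun x _ => hnu₀ x
  obtain ⟨hinj, hsurj⟩ := injective_and_units_of_rules hS ω w
    (fun b => by rw [hω, ← hw, wordClass_spell]) hrule
    (fun u hu => by rw [← heven, (hc.relators _ hu).map_prod_eq nu hcomb]; rfl)
    (fun b => by
      rw [← heven, hw, ← (hc.letters b b.2).map_prod_eq nu hcomb, List.map_singleton,
        List.prod_singleton, hnu₁, letterClass_val])
  exact ⟨⟨hQ, hgroup⟩, nonempty_mulEquiv_units ω hinj hgroup hsurj⟩

/-- The free bottom coefficient `g` is read off from the longer pattern. -/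
theorem exists_prefix_of_agree {X T : Type*} [One T] {a b : List (X × T)} {x x' : X}
    (hab : a.length ≤ b.length)
    (h : ∀ i ≤ a.length, ((a ++ [(x, 1)]).map Prod.fst)[i]? = ((b ++ [(x', 1)]).map Prod.fst)[i]?)
    (h' : ∀ i < a.length, (a.map Prod.snd)[i]? = (b.map Prod.snd)[i]?) :
    ∃ g, a ++ [(x, g)] <+: b ++ [(x', 1)] := by
  induction a generalizing b with
  | nil =>
    have h0 := h 0 le_rfl
    cases b with
    | nil =>
      simp only [List.nil_append, List.map_cons, List.map_nil, List.getElem?_cons_zero,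
        Option.some.injEq] at h0
      exact ⟨1, [], by simp [h0]⟩
    | cons q b =>
      simp only [List.nil_append, List.map_cons, List.cons_append, List.getElem?_cons_zero,
        Option.some.injEq] at h0
      exact ⟨q.2, b ++ [(x', 1)], by simp [h0]⟩
  | cons p a ih =>
    cases b with
    | nil => simp at hab
    | cons q b =>
      have h0 := h 0 (by simp)
      have h0' := h' 0 (by simp)
      simp only [List.map_cons, List.cons_append, List.getElem?_cons_zero,
        Option.some.injEq] at h0 h0'
      obtain ⟨g, d, hd⟩ := ih (b := b) (by simpa using hab)
        (fun i hi => by simpa using h (i + 1) (by simpa using hi))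
        (fun i hi => by simpa using h' (i + 1) (by simpa using hi))
      exact ⟨g, d, by rw [List.cons_append, List.cons_append, hd, Prod.ext h0 h0']; rfl⟩

/-- Completeness. Coefficients are spelled by chosen representatives. A shift at which the rules do
not clash gives instances that overlap, and non-overlap leaves only the case of equal rules at shift
`0`. -/
theorem exists_unitsCertificate (hP : IsKLSemigroup k ℓ P) :
    ∃ Q, IsKLGroup k ℓ Q ∧ ∀ ne : List ℕ → List ℕ → Prop,
      (∀ u v, (∀ b ∈ u, b < Q.1) → (∀ b ∈ v, b < Q.1) → Q.wordClass u ≠ Q.wordClass v → ne u v) →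
      ∃ rules om, UnitsCertificate k ℓ P Q ne rules om := by
  obtain ⟨Q, hQ, ω, rules, om, hno, hω, hrule, hgen⟩ := exists_units_rules hP
  refine ⟨Q, hQ, fun ne hne => ?_⟩
  have hrep : ∀ t : Q.Semigrp, ∃ u : List Q.Alphabet, Q.wordClass (spell u) = t := by
    intro t
    obtain ⟨u, rfl⟩ := PresentedMonoid.surjective_mk t
    exact ⟨u.toList, wordClass_spell _⟩
  choose rep hrep using hrep
  let raw : List (P.Alphabet × Q.Semigrp) × P.Alphabet × Q.Semigrp → RawRule := fun r =>
    (r.1.map fun p => (p.1.1, spell (rep p.2)), r.2.1.1, spell (rep r.2.2))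
  have hspell : ∀ {R : SpecialPresentation} (u : List R.Alphabet), ∀ b ∈ spell u, b < R.1 := by
    intro R u b hb
    obtain ⟨b, -, rfl⟩ := List.mem_map.1 hb
    exact b.2
  have hraw : ∀ l x t, Spells (raw (l, x, t)) l x t := by
    intro l x t
    refine ⟨?_, rfl, (hrep t).symm⟩
    simp [raw, Function.comp_def, hrep]
  have hvalid : ∀ r ∈ rules.map raw, ValidRule P Q r := by
    intro r hr
    obtain ⟨⟨l, x, t⟩, -, rfl⟩ := List.mem_map.1 hr
    refine ⟨x.2, hspell _, fun p hp => ?_⟩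
    obtain ⟨q, -, rfl⟩ := List.mem_map.1 hp
    exact ⟨q.1.2, hspell _⟩
  have homD : ∀ b : Q.Alphabet, (List.ofFn fun b => spell (om b)).getD b [] = spell (om b) := by
    intro b
    rw [List.getD_eq_getElem _ _ (by simp)]
    simp
  have hcomb : ∀ (K : Type) [Monoid K] (f : ℕ → K),
      (∀ r ∈ combinedRules Q (rules.map raw), (r.1.map f).prod = (r.2.map f).prod) →
      (∀ u : List P.Alphabet, spell u ∈ P.2 → (u.map fun x => f (2 * x.1)).prod = 1) ∧
        ∀ b : Q.Alphabet, f (2 * b.1 + 1) = ((om b).map fun x => f (2 * x.1)).prod := by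
    intro K _ f hf
    obtain ⟨β, hβ⟩ := exists_hom_of_relRules (P := Q) (fun b => f (2 * b + 1)) (by
      intro r hr
      obtain ⟨A, hA, rfl⟩ := List.mem_map.1 hr
      have := hf (_, _) (List.mem_append_left _ (List.mem_map_of_mem hA))
      simpa [Function.comp_def] using this)
    have := hgen K (fun x => f (2 * x.1)) β fun r hr =>
      stackValue_eq_of_combinedRules hvalid _ β f (fun _ => rfl)
        (fun b hb => by
          rw [show b = (⟨b, hb⟩ : Q.Alphabet).1 from rfl, letterClass_val, hβ])
        hf (List.mem_map_of_mem hr) (hraw r.1 r.2.1 r.2.2)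
    refine ⟨this.1, fun b => ?_⟩
    rw [← this.2 b, hβ]
  refine ⟨rules.map raw, List.ofFn fun b => spell (om b), hQ.1, ?_, hvalid, ?_, ?_, ?_, ?_, ?_⟩
  · intro b hb
    obtain ⟨u, hu⟩ := hQ.2 (PresentedMonoid.of Q.Rel ⟨b, hb⟩)
    have hb' : Q.wordClass [b] = u := by
      rw [hu, ← letterClass_val, wordClass, List.map_singleton, List.prod_singleton]
    refine ⟨(spell (rep ↑u⁻¹), spell (rep ↑u⁻¹)), rawEq_of_wordClass_eq ?_ (by simp) ?_,
      rawEq_of_wordClass_eq ?_ (by simp) ?_⟩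
    · intro a ha
      rcases List.mem_cons.1 ha with rfl | ha
      · exact hb
      · exact hspell _ _ ha
    · rw [← List.singleton_append, wordClass_append, hb', hrep, Units.mul_inv]
      rfl
    · intro a ha
      rcases List.mem_append.1 ha with ha | ha
      · exact hspell _ _ ha
      · rwa [List.mem_singleton.1 ha]
    · rw [wordClass_append, hb', hrep, Units.inv_mul]
      rfl
  · intro w hw
    obtain ⟨b, rfl⟩ := (List.mem_ofFn' _ _).1 hw
    exact hspell _
  · intro r hr
    refine rawEq_of_forall fun K _ f hf => ?_
    obtain ⟨γ, hγ⟩ := exists_hom_of_relRules f hf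
    rw [prod_map_flatMap, prod_map_flatMap]
    refine combinedRules_prod_eq hQ.1 hvalid (fun x => γ (PresentedMonoid.of P.Rel x))
      (γ.comp ω) (fun n => ((substLetter _ n).map f).prod) ?_ ?_ ?_ r hr
    · intro x
      rw [substLetter_even, List.map_singleton, List.prod_singleton, hγ]
    · intro b hb
      have e := letterClass_val (P := Q) ⟨b, hb⟩
      simp only at e
      rw [substLetter_odd, homD ⟨b, hb⟩, e, MonoidHom.comp_apply, hω, mk_ofList, map_list_prod,
        spell, List.map_map, List.map_map]
      congr 1
      exact List.map_congr_left fun a _ => (hγ a).symm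
    · intro r hr
      obtain ⟨⟨l, x, t⟩, hr₁, rfl⟩ := List.mem_map.1 hr
      refine ⟨l, x, t, hraw l x t, ?_⟩
      have := congrArg γ (hrule _ hr₁)
      rwa [map_stackValue] at this
  · intro A hA
    obtain ⟨u, rfl⟩ := exists_spell (hP.2 A hA).2
    refine rawEq_of_forall fun K _ f hf => ?_
    have := (hcomb K f hf).1 u hA
    simpa [spell, Function.comp_def] using this
  · intro b hb
    refine rawEq_of_forall fun K _ f hf => ?_
    have := (hcomb K f hf).2 ⟨b, hb⟩
    rw [homD ⟨b, hb⟩]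
    simpa [spell, Function.comp_def] using this
  · intro r hr r' hr' j hj
    obtain ⟨⟨l, x, t⟩, hr₁, rfl⟩ := List.mem_map.1 hr
    obtain ⟨⟨l', x', t'⟩, hr₁', rfl⟩ := List.mem_map.1 hr'
    have hs := hraw l x t
    have hs' := hraw l' x' t'
    rw [or_iff_not_imp_left]
    intro hcl
    rw [hs.length_eq] at hj
    have hfst : ∀ i, i + j ≤ l.length → i ≤ l'.length →
        ((l.drop j ++ [(x, 1)]).map Prod.fst)[i]? = ((l' ++ [(x', 1)]).map Prod.fst)[i]? := by
      intro i h1 h2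
      by_contra h3
      refine hcl ⟨i, ⟨by rwa [hs.length_eq], by rwa [hs'.length_eq]⟩, Or.inl fun h4 => h3 ?_⟩
      rw [hs.ruleLetters_eq 1, hs'.ruleLetters_eq 1] at h4
      have h5 : l.drop j ++ [(x, 1)] = (l ++ [(x, 1)]).drop j := by
        rw [List.drop_append_of_le_length (by omega)]
      rw [h5, List.map_drop, List.getElem?_drop, add_comm j i]
      refine Option.map_injective Fin.val_injective ?_
      rw [← List.getElem?_map, ← List.getElem?_map, List.map_map, List.map_map]
      exact h4
    have hsnd : ∀ i, i + j < l.length → i < l'.length →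
        ((l.drop j).map Prod.snd)[i]? = (l'.map Prod.snd)[i]? := by
      intro i h1 h2
      by_contra h3
      refine hcl ⟨i, ⟨by rw [hs.length_eq]; omega, by rw [hs'.length_eq]; omega⟩,
        Or.inr ⟨⟨by rwa [hs.length_eq], by rwa [hs'.length_eq]⟩, hne _ _ ?_ ?_ ?_⟩⟩
      · rw [List.getD_eq_getElem _ _ (by simpa [raw] using h1)]
        simp only [raw, List.map_map, List.getElem_map, Function.comp_apply]
        exact hspell _
      · rw [List.getD_eq_getElem _ _ (by simpa [raw] using h2)]
        simp only [raw, List.map_map, List.getElem_map, Function.comp_apply]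
        exact hspell _
      · rw [hs.wordClass_getD h1, hs'.wordClass_getD h2]
        intro h4
        apply h3
        rw [List.map_drop, List.getElem?_drop, List.getElem?_map, List.getElem?_map, add_comm j i,
          List.getElem?_eq_getElem h1, List.getElem?_eq_getElem h2, Option.map_some,
          Option.map_some, h4]
    have hdrop : ∀ g, l ++ [(x, g)] = l.take j ++ (l.drop j ++ [(x, g)]) := by
      intro g
      rw [← List.append_assoc, List.take_append_drop]
    have key : ∃ g g', l.take j = [] ∧ l.drop j ++ [(x, g)] = l' ++ [(x', g')] ∧
        g * t = g' * t' ∧ (g = 1 ∨ g' = 1) := by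
      rcases le_total (l.length - j) l'.length with hle | hle
      · obtain ⟨g, hg⟩ := exists_prefix_of_agree (a := l.drop j) (b := l') (x := x) (x' := x')
          (by simpa using hle)
          (fun i hi => hfst i (by simp at hi; omega) (by simp at hi; omega))
          (fun i hi => hsnd i (by simp at hi; omega) (by simp at hi; omega))
        obtain ⟨h1, h2, h3⟩ := hno _ _ _ _ (l.take j) (l.drop j ++ [(x, g)]) ⟨l, x, g, t, hr₁, rfl, rfl⟩
          ⟨l', x', 1, t', hr₁', rfl, rfl⟩ (hdrop g) (by simp) (Or.inl hg)
        exact ⟨g, 1, h1, h2, h3, Or.inr rfl⟩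
      · obtain ⟨g, hg⟩ := exists_prefix_of_agree (a := l') (b := l.drop j) (x := x') (x' := x)
          (by simpa using hle)
          (fun i hi => (hfst i (by omega) (by omega)).symm)
          (fun i hi => (hsnd i (by omega) (by omega)).symm)
        obtain ⟨h1, h2, h3⟩ := hno _ _ _ _ (l.take j) (l.drop j ++ [(x, 1)]) ⟨l, x, 1, t, hr₁, rfl, rfl⟩
          ⟨l', x', g, t', hr₁', rfl, rfl⟩ (hdrop 1) (by simp) (Or.inr hg)
        exact ⟨1, g, h1, h2, h3, Or.inl rfl⟩
    obtain ⟨g, g', h1, h2, h3, h8⟩ := key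
    have h4 := congrArg List.length h1
    rw [List.length_take, List.length_nil] at h4
    obtain ⟨h5, h6⟩ := List.append_inj' h2 rfl
    have h7 := congrArg List.length h5
    rw [List.length_drop] at h7
    simp only [List.cons.injEq, Prod.mk.injEq, and_true] at h6
    refine ⟨⟨by omega, by rw [hs.length_eq, hs'.length_eq]; omega⟩,
      rawEq_of_wordClass_eq (hspell _) (hspell _) ?_⟩
    -- One bottom coefficient was chosen to be `1`; equality of the instances forces the other.
    have hg : g = 1 ∧ g' = 1 := by
      rcases h8 with h | h
      · exact ⟨h, h6.2 ▸ h⟩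
      · exact ⟨h6.2 ▸ h, h⟩
    rw [hg.1, hg.2, one_mul, one_mul] at h3
    rw [← hs.2.2, ← hs'.2.2, h3]

end SpecialPresentation

/-! ### Semidecidable predicates -/

section Semidecidability

variable {α β : Type*} [Primcodable α] [Primcodable β]

/-- The projections of primitive recursive relations. -/
def Semidecidable (p : α → Prop) : Prop :=
  ∃ q : α → ℕ → Prop, PrimrecRel q ∧ ∀ a, p a ↔ ∃ n, q a n

theorem PrimrecPred.semidecidable {p : α → Prop} (hp : PrimrecPred p) : Semidecidable p :=
  ⟨fun a _ => p a, PrimrecPred.comp hp Primrec.fst, fun _ => by simp⟩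

namespace Semidecidable

theorem of_eq {p p' : α → Prop} (hp : Semidecidable p) (h : ∀ a, p a ↔ p' a) :
    Semidecidable p' :=
  (funext fun a => propext (h a) : p = p') ▸ hp

theorem comp {p : β → Prop} (hp : Semidecidable p) {f : α → β} (hf : Primrec f) :
    Semidecidable fun a => p (f a) := by
  obtain ⟨q, hq, h⟩ := hp
  exact ⟨fun a n => q (f a) n, hq.comp (hf.comp Primrec.fst) Primrec.snd, fun a => h (f a)⟩

theorem exists_mem {p : α → β → Prop} (hp : Semidecidable fun x : α × β => p x.1 x.2) :
    Semidecidable fun a => ∃ b, p a b := by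
  obtain ⟨q, hq, h⟩ := hp
  -- The number `n` codes a candidate `b` and a witness for it.
  refine ⟨fun a n => ∃ b ∈ (Encodable.decode (α := β) n.unpair.1).toList, q (a, b) n.unpair.2,
    ?_, fun a => ?_⟩
  · have h1 : PrimrecRel fun (b : β) (y : α × ℕ) => q (y.1, b) y.2 :=
      hq.comp ((Primrec.fst.comp Primrec.snd).pair Primrec.fst) (Primrec.snd.comp Primrec.snd)
    exact h1.exists_mem_list.comp
      (Primrec.optionToList.comp (Primrec.decode.comp
        (Primrec.fst.comp (Primrec.unpair.comp Primrec.snd))))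
      (Primrec.fst.pair (Primrec.snd.comp (Primrec.unpair.comp Primrec.snd)))
  · constructor
    · rintro ⟨b, hb⟩
      obtain ⟨n, hn⟩ := (h (a, b)).1 hb
      exact ⟨Nat.pair (Encodable.encode b) n, b, by simp, by simpa using hn⟩
    · rintro ⟨n, b, -, hb⟩
      exact ⟨b, (h (a, b)).2 ⟨_, hb⟩⟩

/-- Finitely many witnesses have a common bound `N`, which becomes the single unbounded quantifier.
-/
theorem forall_mem_list {p : α → β → Prop} (hp : Semidecidable fun x : α × β => p x.1 x.2)
    {f : α → List β} (hf : Primrec f) : Semidecidable fun a => ∀ b ∈ f a, p a b := by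
  obtain ⟨q, hq, h⟩ := hp
  refine ⟨fun a N => ∀ b ∈ f a, ∃ m ∈ List.range N, q (a, b) m, ?_, fun a => ?_⟩
  · have h1 : PrimrecRel fun (m : ℕ) (y : α × β) => q y m := hq.comp Primrec.snd Primrec.fst
    have h2 : PrimrecRel fun (b : β) (y : α × ℕ) => ∃ m ∈ List.range y.2, q (y.1, b) m :=
      h1.exists_mem_list.comp (Primrec.list_range.comp (Primrec.snd.comp Primrec.snd))
        ((Primrec.fst.comp Primrec.snd).pair Primrec.fst)
    exact h2.forall_mem_list.comp (hf.comp Primrec.fst) Primrec.id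
  · have key : ∀ L : List β, (∀ b ∈ L, p a b) ↔
        ∃ N, ∀ b ∈ L, ∃ m ∈ List.range N, q (a, b) m := by
      intro L
      constructor
      · induction L with
        | nil => exact fun _ => ⟨0, by simp⟩
        | cons b L ih =>
          intro hL
          obtain ⟨N, hN⟩ := ih fun b hb => hL b (List.mem_cons_of_mem _ hb)
          obtain ⟨m, hm⟩ := (h (a, b)).1 (hL b List.mem_cons_self)
          refine ⟨max N (m + 1), fun c hc => ?_⟩
          rcases List.mem_cons.1 hc with rfl | hc
          · exact ⟨m, by simp, hm⟩
          · obtain ⟨m', hm', hq'⟩ := hN c hc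
            exact ⟨m', by simp at hm' ⊢; omega, hq'⟩
      · rintro ⟨N, hN⟩ b hb
        obtain ⟨m, -, hm⟩ := hN b hb
        exact (h (a, b)).2 ⟨m, hm⟩
    exact key (f a)

theorem and {p p' : α → Prop} (hp : Semidecidable p) (hp' : Semidecidable p') :
    Semidecidable fun a => p a ∧ p' a := by
  obtain ⟨q, hq, h⟩ := hp
  obtain ⟨q', hq', h'⟩ := hp'
  refine ⟨fun a n => q a n.unpair.1 ∧ q' a n.unpair.2,
    PrimrecPred.and
      (hq.comp Primrec.fst (Primrec.fst.comp (Primrec.unpair.comp Primrec.snd)))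
      (hq'.comp Primrec.fst (Primrec.snd.comp (Primrec.unpair.comp Primrec.snd))), fun a => ?_⟩
  change p a ∧ p' a ↔ _
  rw [h, h']
  constructor
  · rintro ⟨⟨n, hn⟩, m, hm⟩
    exact ⟨Nat.pair n m, by simpa using ⟨hn, hm⟩⟩
  · rintro ⟨n, h1, h2⟩
    exact ⟨⟨_, h1⟩, _, h2⟩

theorem or {p p' : α → Prop} (hp : Semidecidable p) (hp' : Semidecidable p') :
    Semidecidable fun a => p a ∨ p' a := by
  obtain ⟨q, hq, h⟩ := hp
  obtain ⟨q', hq', h'⟩ := hp'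
  refine ⟨fun a n => q a n ∨ q' a n, PrimrecPred.or hq hq', fun a => ?_⟩
  change p a ∨ p' a ↔ _
  rw [h, h', exists_or]

/-- A semidecidable relation has a partial computable choice function. -/
theorem exists_partrec {p : α → β → Prop} (hp : Semidecidable fun x : α × β => p x.1 x.2) :
    ∃ F : α →. β, Partrec F ∧ (∀ a, ∀ b ∈ F a, p a b) ∧ ∀ a b, p a b → ∃ b', b' ∈ F a := by
  classical
  obtain ⟨q, hq, h⟩ := hp
  -- The search runs over codes `m` of a candidate and a witness.
  let f : α → ℕ → Option β := fun a m => (Encodable.decode (α := β) m.unpair.1).bind fun b =>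
    if q (a, b) m.unpair.2 then some b else none
  have hf : Primrec₂ f := by
    refine Primrec.option_bind (Primrec.decode.comp
      (Primrec.fst.comp (Primrec.unpair.comp Primrec.snd))) (Primrec.ite ?_
        (Primrec.option_some.comp Primrec.snd) (Primrec.const none))
    exact hq.comp ((Primrec.fst.comp Primrec.fst).pair Primrec.snd)
      (Primrec.snd.comp (Primrec.unpair.comp (Primrec.snd.comp Primrec.fst)))
  have hf' : ∀ a b, (∃ m, b ∈ f a m) ↔ p a b := by
    intro a b
    refine Iff.trans ?_ (h (a, b)).symm
    constructor
    · rintro ⟨m, hm⟩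
      obtain ⟨b', -, hb'⟩ := Option.bind_eq_some_iff.1 hm
      split_ifs at hb' with hqm
      cases hb'
      exact ⟨_, hqm⟩
    · rintro ⟨n, hn⟩
      exact ⟨Nat.pair (Encodable.encode b) n, by simp [f, hn]⟩
  refine ⟨fun a => Nat.rfindOpt (f a), Partrec.rfindOpt hf.to_comp, fun a b hb => ?_,
    fun a b hb => ?_⟩
  · exact (hf' a b).1 (Nat.rfindOpt_spec hb)
  · obtain ⟨m, hm⟩ := (hf' a b).2 hb
    exact Part.dom_iff_mem.1 (Nat.rfindOpt_dom.2 ⟨m, b, hm⟩)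

end Semidecidable

theorem Semidecidable.mem_code_eval (m : ℕ) :
    Semidecidable fun x : Nat.Partrec.Code × ℕ => m ∈ x.1.eval x.2 := by
  refine ⟨fun x n => Nat.Partrec.Code.evaln n x.1 x.2 = some m, ?_, fun x => ?_⟩
  · exact Primrec.eq.comp (Nat.Partrec.Code.primrec_evaln.comp
      ((Primrec.snd.pair (Primrec.fst.comp Primrec.fst)).pair (Primrec.snd.comp Primrec.fst)))
      (Primrec.const _)
  · exact Nat.Partrec.Code.evaln_complete

end Semidecidability

/-! ### Searching for a certificate -/

namespace SpecialPresentation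

/-- One application of one of the rules `R` or of its inverse. -/
def RewriteStep (R : List (List ℕ × List ℕ)) (u v : List ℕ) : Prop :=
  ∃ s : List ℕ × List ℕ × List ℕ × List ℕ, (u = s.1 ++ s.2.1 ++ s.2.2.2 ∧
    ((s.2.1, s.2.2.1) ∈ R ∨ (s.2.2.1, s.2.1) ∈ R)) ∧ v = s.1 ++ s.2.2.1 ++ s.2.2.2

theorem rawEq_iff_reflTransGen {R : List (List ℕ × List ℕ)} {u v : List ℕ} :
    RawEq R u v ↔ Relation.ReflTransGen (RewriteStep R) u v := by
  have happ : ∀ {u v : List ℕ} (x y : List ℕ), Relation.ReflTransGen (RewriteStep R) u v →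
      Relation.ReflTransGen (RewriteStep R) (x ++ u ++ y) (x ++ v ++ y) := by
    intro u v x y h
    refine Relation.ReflTransGen.lift (fun w => x ++ w ++ y) ?_ _ _ h
    rintro a b ⟨⟨p, l, r, q⟩, ⟨rfl, hR⟩, rfl⟩
    exact ⟨(x ++ p, l, r, q ++ y), ⟨by simp, hR⟩, by simp⟩
  constructor
  · intro h
    let C : Con (FreeMonoid ℕ) :=
      { r := fun a b => Relation.ReflTransGen (RewriteStep R) a.toList b.toList
        iseqv :=
          { refl := fun _ => Relation.ReflTransGen.refl
            symm := by
              intro a b h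
              have : Std.Symm (RewriteStep R) := ⟨by
                rintro a b ⟨⟨p, l, r, q⟩, ⟨rfl, hR⟩, rfl⟩
                exact ⟨(p, r, l, q), ⟨rfl, hR.symm⟩, rfl⟩⟩
              exact Std.Symm.symm _ _ h
            trans := Relation.ReflTransGen.trans }
        mul' := by
          intro a b c d hab hcd
          have h1 := happ [] c.toList hab
          have h2 := happ b.toList [] hcd
          simp only [List.nil_append, List.append_nil] at h1 h2
          simpa using h1.trans h2 }
    have hC : conGen (fun a b : FreeMonoid ℕ => (a.toList, b.toList) ∈ R) ≤ C := by
      rw [Con.conGen_le]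
      intro a b hab
      exact Relation.ReflTransGen.single ⟨([], a.toList, b.toList, []), ⟨by simp, Or.inl hab⟩,
        by simp⟩
    exact hC h
  · intro h
    refine rawEq_of_forall fun K _ f hf => ?_
    induction h with
    | refl => rfl
    | tail _ hstep ih =>
      rw [ih]
      obtain ⟨⟨p, l, r, q⟩, ⟨rfl, hR⟩, rfl⟩ := hstep
      have : (l.map f).prod = (r.map f).prod := by
        rcases hR with h | h
        · exact hf _ h
        · exact (hf _ h).symm
      simp [this]

open Classical in
/-- Perform the rewriting step described by `s` if possible. -/
noncomputable def performStep (R : List (List ℕ × List ℕ)) (u : List ℕ)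
    (s : List ℕ × List ℕ × List ℕ × List ℕ) : List ℕ :=
  if u = s.1 ++ s.2.1 ++ s.2.2.2 ∧ ((s.2.1, s.2.2.1) ∈ R ∨ (s.2.2.1, s.2.1) ∈ R) then
    s.1 ++ s.2.2.1 ++ s.2.2.2 else u

/-- An inapplicable step changes nothing, so every list of steps is a valid derivation, and checking
where it ends is a primitive recursive fold. -/
theorem rawEq_iff_exists_foldl {R : List (List ℕ × List ℕ)} {u v : List ℕ} :
    RawEq R u v ↔ ∃ steps : List (List ℕ × List ℕ × List ℕ × List ℕ),
      steps.foldl (performStep R) u = v := by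
  rw [rawEq_iff_reflTransGen]
  constructor
  · intro h
    induction h with
    | refl => exact ⟨[], rfl⟩
    | tail _ hstep ih =>
      obtain ⟨steps, rfl⟩ := ih
      obtain ⟨s, hs, rfl⟩ := hstep
      refine ⟨steps ++ [s], ?_⟩
      rw [List.foldl_append, List.foldl_cons, List.foldl_nil, performStep, if_pos hs]
  · rintro ⟨steps, rfl⟩
    induction steps generalizing u with
    | nil => exact Relation.ReflTransGen.refl
    | cons s steps ih =>
      rw [List.foldl_cons]
      refine Relation.ReflTransGen.trans ?_ ih
      unfold performStep
      split_ifs with h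
      · exact Relation.ReflTransGen.single ⟨s, h, rfl⟩
      · exact Relation.ReflTransGen.refl

theorem primrecRel_mem_list {α : Type*} [Primcodable α] :
    PrimrecRel fun (a : α) (L : List α) => a ∈ L :=
  ((PrimrecRel.exists_mem_list Primrec.eq).comp Primrec.snd Primrec.fst).of_eq
    fun x => by simp

theorem semidecidable_rawEq {α : Type*} [Primcodable α] {R : α → List (List ℕ × List ℕ)}
    {u v : α → List ℕ} (hR : Primrec R) (hu : Primrec u) (hv : Primrec v) :
    Semidecidable fun a => RawEq (R a) (u a) (v a) := by
  classical
  have hstep : Primrec fun x : List (List ℕ × List ℕ) × List ℕ ×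
      (List ℕ × List ℕ × List ℕ × List ℕ) => performStep x.1 x.2.1 x.2.2 := by
    have h0 : Primrec fun x : List (List ℕ × List ℕ) × List ℕ ×
      (List ℕ × List ℕ × List ℕ × List ℕ) => x.2.2 := Primrec.snd.comp Primrec.snd
    have hp := Primrec.fst.comp h0
    have hl := Primrec.fst.comp (Primrec.snd.comp h0)
    have hr := Primrec.fst.comp (Primrec.snd.comp (Primrec.snd.comp h0))
    have hq := Primrec.snd.comp (Primrec.snd.comp (Primrec.snd.comp h0))
    refine Primrec.ite (PrimrecPred.and ?_ (PrimrecPred.or ?_ ?_)) ?_ ?_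
    · exact Primrec.eq.comp (Primrec.fst.comp Primrec.snd)
        (Primrec.list_append.comp (Primrec.list_append.comp hp hl) hq)
    · exact primrecRel_mem_list.comp (hl.pair hr) Primrec.fst
    · exact primrecRel_mem_list.comp (hr.pair hl) Primrec.fst
    · exact Primrec.list_append.comp (Primrec.list_append.comp hp hr) hq
    · exact Primrec.fst.comp Primrec.snd
  refine Semidecidable.of_eq (p := fun a => ∃ steps : List (List ℕ × List ℕ × List ℕ × List ℕ),
    steps.foldl (performStep (R a)) (u a) = v a) (Semidecidable.exists_mem
      (PrimrecPred.semidecidable (Primrec.eq.comp ?_ (hv.comp Primrec.fst))))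
    fun a => rawEq_iff_exists_foldl.symm
  exact Primrec.list_foldl Primrec.snd (hu.comp Primrec.fst)
    (hstep.comp ((hR.comp (Primrec.fst.comp Primrec.fst)).pair Primrec.snd)).to₂

theorem primrec_odd : Primrec fun b : ℕ => 2 * b + 1 :=
  Primrec.succ.comp (Primrec.nat_mul.comp (Primrec.const 2) Primrec.id)

theorem primrec_even : Primrec fun b : ℕ => 2 * b :=
  Primrec.nat_mul.comp (Primrec.const 2) Primrec.id

theorem primrec_relRules : Primrec relRules :=
  Primrec.list_map Primrec.snd (Primrec.snd.pair (Primrec.const [])).to₂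

theorem primrec_ruleWord : Primrec ruleWord := by
  refine Primrec.list_cons.comp (primrec_even.comp (Primrec.fst.comp Primrec.snd))
    (Primrec.list_flatMap (Primrec.list_reverse.comp Primrec.fst) ?_)
  exact Primrec.list_append.comp
    (Primrec.list_map (Primrec.snd.comp Primrec.snd) (primrec_odd.comp Primrec.snd).to₂)
    (Primrec.list_cons.comp (primrec_even.comp (Primrec.fst.comp Primrec.snd)) (Primrec.const []))

theorem primrec_combinedRules : Primrec₂ combinedRules := by
  refine Primrec.list_append.comp (Primrec.list_map (Primrec.snd.comp Primrec.fst) ?_)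
    (Primrec.list_map Primrec.snd ?_)
  · exact (Primrec.list_map Primrec.snd (primrec_odd.comp Primrec.snd).to₂).pair
      (Primrec.const [])
  · exact (primrec_ruleWord.comp Primrec.snd).pair
      (Primrec.list_map (Primrec.snd.comp (Primrec.snd.comp Primrec.snd))
        (primrec_odd.comp Primrec.snd).to₂)

theorem primrec_substLetter : Primrec₂ substLetter := by
  refine Primrec.ite (Primrec.eq.comp (Primrec.nat_mod.comp Primrec.snd (Primrec.const 2))
    (Primrec.const 0)) ?_ ?_
  · exact Primrec.list_cons.comp (Primrec.nat_div.comp Primrec.snd (Primrec.const 2))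
      (Primrec.const [])
  · exact (Primrec.list_getD []).comp Primrec.fst
      (Primrec.nat_div.comp Primrec.snd (Primrec.const 2))

theorem primrec_ruleLetters : Primrec ruleLetters :=
  Primrec.list_append.comp (Primrec.list_map Primrec.fst (Primrec.fst.comp Primrec.snd).to₂)
    (Primrec.list_cons.comp (Primrec.fst.comp Primrec.snd) (Primrec.const []))

/-- The program `c` states that two words are different in the semigroup presented by `Q`. -/
def StatesNe (c : Nat.Partrec.Code) (Q : SpecialPresentation) (u v : List ℕ) : Prop :=
  0 ∈ c.eval (Encodable.encode (Q, u, v))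

theorem primrecPred_forall_mem_list {α β : Type*} [Primcodable α] [Primcodable β]
    {p : α → β → Prop} (hp : PrimrecPred fun x : α × β => p x.1 x.2) {f : α → List β}
    (hf : Primrec f) : PrimrecPred fun a => ∀ b ∈ f a, p a b := by
  have h : PrimrecRel fun (b : β) (a : α) => p a b :=
    PrimrecPred.comp hp (Primrec.snd.pair Primrec.fst)
  exact h.forall_mem_list.comp hf Primrec.id

theorem primrecPred_forall_lt {α : Type*} [Primcodable α] {f : α → List ℕ} {m : α → ℕ}
    (hf : Primrec f) (hm : Primrec m) : PrimrecPred fun a => ∀ b ∈ f a, b < m a := by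
  refine primrecPred_forall_mem_list ?_ hf
  exact Primrec.nat_lt.comp Primrec.snd (hm.comp Primrec.fst)

theorem primrecPred_isKLSemigroup {α : Type*} [Primcodable α] {k ℓ : α → ℕ}
    {Q : α → SpecialPresentation} (hk : Primrec k) (hℓ : Primrec ℓ) (hQ : Primrec Q) :
    PrimrecPred fun a => IsKLSemigroup (k a) (ℓ a) (Q a) := by
  have h : PrimrecPred fun a => ∀ A ∈ (Q a).2, A.length ≤ ℓ a ∧ ∀ x ∈ A, x < (Q a).1 := by
    refine primrecPred_forall_mem_list ?_ (Primrec.snd.comp hQ)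
    refine PrimrecPred.and ?_ ?_
    · exact Primrec.nat_le.comp (Primrec.list_length.comp Primrec.snd) (hℓ.comp Primrec.fst)
    · exact primrecPred_forall_lt Primrec.snd (Primrec.fst.comp (hQ.comp Primrec.fst))
  have h' : PrimrecPred fun a => (Q a).2.length = k a :=
    Primrec.eq.comp (Primrec.list_length.comp (Primrec.snd.comp hQ)) hk
  exact h'.and h

theorem primrecPred_validRule {α : Type*} [Primcodable α] {P Q : α → SpecialPresentation}
    {r : α → RawRule} (hP : Primrec P) (hQ : Primrec Q) (hr : Primrec r) :
    PrimrecPred fun a => ValidRule (P a) (Q a) (r a) := by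
  have hP' := Primrec.fst.comp hP
  have hQ' := Primrec.fst.comp hQ
  have h1 : PrimrecPred fun a => (r a).2.1 < (P a).1 :=
    Primrec.nat_lt.comp (Primrec.fst.comp (Primrec.snd.comp hr)) hP'
  have h2 : PrimrecPred fun a => ∀ b ∈ (r a).2.2, b < (Q a).1 :=
    primrecPred_forall_lt (Primrec.snd.comp (Primrec.snd.comp hr)) hQ'
  have h3 : PrimrecPred fun a => ∀ p ∈ (r a).1, p.1 < (P a).1 ∧ ∀ b ∈ p.2, b < (Q a).1 := by
    refine primrecPred_forall_mem_list ?_ (Primrec.fst.comp hr)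
    refine PrimrecPred.and ?_ ?_
    · exact Primrec.nat_lt.comp (Primrec.fst.comp Primrec.snd) (hP'.comp Primrec.fst)
    · exact primrecPred_forall_lt (Primrec.snd.comp Primrec.snd) (hQ'.comp Primrec.fst)
  exact h1.and (h2.and h3)

theorem semidecidable_rulesClash {α : Type*} [Primcodable α] {c : α → Nat.Partrec.Code}
    {Q : α → SpecialPresentation} {r r' : α → RawRule} {j : α → ℕ} (hc : Primrec c)
    (hQ : Primrec Q) (hr : Primrec r) (hr' : Primrec r') (hj : Primrec j) :
    Semidecidable fun a => RulesClash (StatesNe (c a) (Q a)) (r a) (r' a) (j a) := by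
  replace hc := hc.comp (Primrec.fst (α := α) (β := ℕ))
  replace hQ := hQ.comp (Primrec.fst (α := α) (β := ℕ))
  replace hr := hr.comp (Primrec.fst (α := α) (β := ℕ))
  replace hr' := hr'.comp (Primrec.fst (α := α) (β := ℕ))
  have hij := Primrec.nat_add.comp (Primrec.snd (α := α) (β := ℕ)) (hj.comp Primrec.fst)
  have hi := Primrec.snd (α := α) (β := ℕ)
  have hlen := Primrec.list_length.comp (Primrec.fst.comp hr)
  have hlen' := Primrec.list_length.comp (Primrec.fst.comp hr')
  have hsnd : Primrec fun r : RawRule => r.1.map Prod.snd :=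
    Primrec.list_map Primrec.fst (Primrec.snd.comp Primrec.snd).to₂
  have h1 : PrimrecPred fun x : α × ℕ => x.2 + j x.1 ≤ (r x.1).1.length :=
    Primrec.nat_le.comp hij hlen
  have h2 : PrimrecPred fun x : α × ℕ => x.2 ≤ (r' x.1).1.length := Primrec.nat_le.comp hi hlen'
  have h3 : PrimrecPred fun x : α × ℕ => x.2 + j x.1 < (r x.1).1.length :=
    Primrec.nat_lt.comp hij hlen
  have h4 : PrimrecPred fun x : α × ℕ => x.2 < (r' x.1).1.length := Primrec.nat_lt.comp hi hlen'
  have h5 : PrimrecPred fun x : α × ℕ =>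
      (ruleLetters (r x.1))[x.2 + j x.1]? ≠ (ruleLetters (r' x.1))[x.2]? :=
    PrimrecPred.not (Primrec.eq.comp
      (Primrec.list_getElem?.comp (primrec_ruleLetters.comp hr) hij)
      (Primrec.list_getElem?.comp (primrec_ruleLetters.comp hr') hi))
  have h6 : Semidecidable fun x : α × ℕ => StatesNe (c x.1) (Q x.1)
      (((r x.1).1.map Prod.snd).getD (x.2 + j x.1) []) (((r' x.1).1.map Prod.snd).getD x.2 []) :=
    (Semidecidable.mem_code_eval 0).comp (hc.pair (Primrec.encode.comp (hQ.pair
      (((Primrec.list_getD []).comp (hsnd.comp hr) hij).pair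
        ((Primrec.list_getD []).comp (hsnd.comp hr') hi)))))
  exact Semidecidable.exists_mem ((h1.semidecidable.and h2.semidecidable).and
    (h5.semidecidable.or ((h3.semidecidable.and h4.semidecidable).and h6)))

theorem semidecidable_unitsCertificate {α : Type*} [Primcodable α] {k ℓ : α → ℕ}
    {c : α → Nat.Partrec.Code} {P Q : α → SpecialPresentation} {rules : α → List RawRule}
    {om : α → List (List ℕ)} (hk : Primrec k) (hℓ : Primrec ℓ) (hc : Primrec c) (hP : Primrec P)
    (hQ : Primrec Q) (hrules : Primrec rules) (hom : Primrec om) :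
    Semidecidable fun a => UnitsCertificate (k a) (ℓ a) (P a) (Q a) (StatesNe (c a) (Q a))
      (rules a) (om a) := by
  have hrange := Primrec.list_range.comp (Primrec.fst.comp hQ)
  have hcomb := primrec_combinedRules.comp hQ hrules
  have h1 : Semidecidable fun a => ∀ b ∈ List.range (Q a).1, ∃ v : List ℕ × List ℕ,
      RawEq (relRules (Q a)) (b :: v.1) [] ∧ RawEq (relRules (Q a)) (v.2 ++ [b]) [] := by
    refine Semidecidable.forall_mem_list ?_ hrange
    refine Semidecidable.exists_mem ?_
    refine Semidecidable.and ?_ ?_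
    · exact semidecidable_rawEq (primrec_relRules.comp (hQ.comp (Primrec.fst.comp Primrec.fst)))
        (Primrec.list_cons.comp (Primrec.snd.comp Primrec.fst) (Primrec.fst.comp Primrec.snd))
        (Primrec.const [])
    · exact semidecidable_rawEq (primrec_relRules.comp (hQ.comp (Primrec.fst.comp Primrec.fst)))
        (Primrec.list_append.comp (Primrec.snd.comp Primrec.snd)
          (Primrec.list_cons.comp (Primrec.snd.comp Primrec.fst) (Primrec.const [])))
        (Primrec.const [])
  have h2 : PrimrecPred fun a => ∀ r ∈ rules a, ValidRule (P a) (Q a) r := by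
    refine primrecPred_forall_mem_list ?_ hrules
    exact primrecPred_validRule (hP.comp Primrec.fst) (hQ.comp Primrec.fst) Primrec.snd
  have h3 : PrimrecPred fun a => ∀ w ∈ om a, ∀ x ∈ w, x < (P a).1 := by
    refine primrecPred_forall_mem_list ?_ hom
    exact primrecPred_forall_lt Primrec.snd (Primrec.fst.comp (hP.comp Primrec.fst))
  have h4 : Semidecidable fun a => ∀ r ∈ combinedRules (Q a) (rules a),
      RawEq (relRules (P a)) (r.1.flatMap (substLetter (om a)))
        (r.2.flatMap (substLetter (om a))) := by
    have hs : Primrec₂ fun (x : α × List ℕ × List ℕ) (n : ℕ) => substLetter (om x.1) n :=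
      primrec_substLetter.comp (hom.comp (Primrec.fst.comp Primrec.fst)) Primrec.snd
    refine Semidecidable.forall_mem_list ?_ hcomb
    exact semidecidable_rawEq (primrec_relRules.comp (hP.comp Primrec.fst))
      (Primrec.list_flatMap (Primrec.fst.comp Primrec.snd) hs)
      (Primrec.list_flatMap (Primrec.snd.comp Primrec.snd) hs)
  have h5 : Semidecidable fun a => ∀ A ∈ (P a).2,
      RawEq (combinedRules (Q a) (rules a)) (A.map fun x => 2 * x) [] := by
    refine Semidecidable.forall_mem_list ?_ (Primrec.snd.comp hP)
    exact semidecidable_rawEq (hcomb.comp Primrec.fst)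
      (Primrec.list_map Primrec.snd (primrec_even.comp Primrec.snd).to₂) (Primrec.const [])
  have h6 : Semidecidable fun a => ∀ b ∈ List.range (Q a).1,
      RawEq (combinedRules (Q a) (rules a)) [2 * b + 1]
        (((om a).getD b []).map fun x => 2 * x) := by
    refine Semidecidable.forall_mem_list ?_ hrange
    exact semidecidable_rawEq (hcomb.comp Primrec.fst)
      (Primrec.list_cons.comp (primrec_odd.comp Primrec.snd) (Primrec.const []))
      (Primrec.list_map ((Primrec.list_getD []).comp (hom.comp Primrec.fst) Primrec.snd)
        (primrec_even.comp Primrec.snd).to₂)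
  have h7 : Semidecidable fun a => ∀ r ∈ rules a, ∀ r' ∈ rules a, ∀ j ∈ List.range (r.1.length + 1),
      RulesClash (StatesNe (c a) (Q a)) r r' j ∨
        ((j = 0 ∧ r.1.length = r'.1.length) ∧ RawEq (relRules (Q a)) r.2.2 r'.2.2) := by
    refine Semidecidable.forall_mem_list ?_ hrules
    refine Semidecidable.forall_mem_list ?_ (hrules.comp Primrec.fst)
    refine Semidecidable.forall_mem_list ?_ (Primrec.list_range.comp (Primrec.succ.comp
      (Primrec.list_length.comp (Primrec.fst.comp (Primrec.snd.comp Primrec.fst)))))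
    have ha : Primrec fun x : ((α × RawRule) × RawRule) × ℕ => x.1.1.1 :=
      Primrec.fst.comp (Primrec.fst.comp Primrec.fst)
    have hr : Primrec fun x : ((α × RawRule) × RawRule) × ℕ => x.1.1.2 :=
      Primrec.snd.comp (Primrec.fst.comp Primrec.fst)
    have hr' : Primrec fun x : ((α × RawRule) × RawRule) × ℕ => x.1.2 :=
      Primrec.snd.comp Primrec.fst
    refine Semidecidable.or (semidecidable_rulesClash (hc.comp ha) (hQ.comp ha) hr hr'
      Primrec.snd) (Semidecidable.and (Semidecidable.and
        (Primrec.eq.comp Primrec.snd (Primrec.const 0)).semidecidable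
        (Primrec.eq.comp (Primrec.list_length.comp (Primrec.fst.comp hr))
          (Primrec.list_length.comp (Primrec.fst.comp hr'))).semidecidable) ?_)
    exact semidecidable_rawEq (primrec_relRules.comp (hQ.comp ha))
      (Primrec.snd.comp (Primrec.snd.comp hr)) (Primrec.snd.comp (Primrec.snd.comp hr'))
  refine ((primrecPred_isKLSemigroup hk hℓ hQ).semidecidable.and (h1.and (h2.semidecidable.and
    (h3.semidecidable.and (h4.and (h5.and (h6.and h7))))))).of_eq fun a => ?_
  simp only [List.mem_range]
  constructor
  · rintro ⟨g0, g1, g2, g3, g4, g5, g6, g7⟩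
    exact ⟨g0, g1, g2, g3, g4, g5, g6, g7⟩
  · rintro ⟨g0, g1, g2, g3, g4, g5, g6, g7⟩
    exact ⟨g0, g1, g2, g3, g4, g5, g6, g7⟩

/-- The only place where the correctness of the program enters; it is limited to `(k, ℓ)`-groups and
words over the alphabet. -/
theorem statesNe_iff {k ℓ : ℕ} {c : Nat.Partrec.Code}
    (hc : SolvesIdentityProblem k ℓ c) {Q : SpecialPresentation} (hQ : IsKLGroup k ℓ Q)
    {u v : List ℕ} (hu : ∀ b ∈ u, b < Q.1) (hv : ∀ b ∈ v, b < Q.1) :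
    StatesNe c Q u v ↔ Q.wordClass u ≠ Q.wordClass v := by
  obtain ⟨u, rfl⟩ := exists_spell hu
  obtain ⟨v, rfl⟩ := exists_spell hv
  rw [wordClass_spell, wordClass_spell, StatesNe]
  obtain ⟨h1, h2⟩ := hc Q hQ u v
  by_cases h : WordsEqual Q u v
  · rw [h1 h]
    simpa using (show PresentedMonoid.mk Q.Rel _ = _ from h)
  · rw [h2 h]
    simpa using (show ¬ PresentedMonoid.mk Q.Rel _ = _ from h)

theorem exists_partrec_groupOfUnits :
    ∃ F : ℕ × ℕ × Nat.Partrec.Code × SpecialPresentation →. SpecialPresentation, Partrec F ∧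
      ∀ (k ℓ : ℕ) (c : Nat.Partrec.Code), SolvesIdentityProblem k ℓ c →
        ∀ P : SpecialPresentation, IsKLSemigroup k ℓ P →
          ∃ Q ∈ F (k, ℓ, c, P), IsKLGroupOfUnits k ℓ P Q := by
  have hsd : Semidecidable fun x : (ℕ × ℕ × Nat.Partrec.Code × SpecialPresentation) ×
      SpecialPresentation => ∃ cert : List RawRule × List (List ℕ),
        UnitsCertificate x.1.1 x.1.2.1 x.1.2.2.2 x.2 (StatesNe x.1.2.2.1 x.2) cert.1 cert.2 := by
    refine Semidecidable.exists_mem ?_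
    have h0 : Primrec fun y : ((ℕ × ℕ × Nat.Partrec.Code × SpecialPresentation) ×
        SpecialPresentation) × List RawRule × List (List ℕ) => y.1.1 :=
      Primrec.fst.comp Primrec.fst
    exact semidecidable_unitsCertificate (Primrec.fst.comp h0)
      (Primrec.fst.comp (Primrec.snd.comp h0))
      (Primrec.fst.comp (Primrec.snd.comp (Primrec.snd.comp h0)))
      (Primrec.snd.comp (Primrec.snd.comp (Primrec.snd.comp h0)))
      (Primrec.snd.comp Primrec.fst) (Primrec.fst.comp Primrec.snd) (Primrec.snd.comp Primrec.snd)
  obtain ⟨F, hF, hsound, hdom⟩ := Semidecidable.exists_partrec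
    (p := fun (i : ℕ × ℕ × Nat.Partrec.Code × SpecialPresentation) (Q : SpecialPresentation) =>
      ∃ cert : List RawRule × List (List ℕ),
        UnitsCertificate i.1 i.2.1 i.2.2.2 Q (StatesNe i.2.2.1 Q) cert.1 cert.2) hsd
  refine ⟨F, hF, fun k ℓ c hc P hP => ?_⟩
  obtain ⟨Q₀, hQ₀, hcert⟩ := exists_unitsCertificate hP
  obtain ⟨rules, om, hcert⟩ := hcert (StatesNe c Q₀) fun u v hu hv h =>
    (statesNe_iff hc hQ₀ hu hv).2 h
  -- `Q₀` only guarantees that the search stops; it may stop at another `Q`, whose certificate is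
  -- equally sound.
  obtain ⟨Q, hQ⟩ := hdom (k, ℓ, c, P) Q₀ ⟨(rules, om), hcert⟩
  obtain ⟨cert, h⟩ := hsound _ _ hQ
  exact ⟨Q, hQ, h.isKLGroupOfUnits hP fun hgr u v hu hv hne =>
    (statesNe_iff hc hgr hu hv).1 hne⟩

end SpecialPresentation

/-! ### Finiteness of the set of `(k, ℓ)`-groups and the non-uniform statement -/

namespace SpecialPresentation

variable {P : SpecialPresentation} {k ℓ : ℕ}

/-- Counting the occurrences of a letter absent from all relators would be a homomorphism to the
additive monoid `ℕ`, where `1` is not invertible. -/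
theorem IsKLGroup.exists_mem_relator (hP : IsKLGroup k ℓ P) {b : ℕ} (hb : b < P.1) :
    ∃ A ∈ P.2, b ∈ A := by
  by_contra hcon
  push Not at hcon
  let f : P.Semigrp →* Multiplicative ℕ := PresentedMonoid.lift
    (fun a : P.Alphabet => if a.1 = b then Multiplicative.ofAdd 1 else 1) (by
      rintro u v ⟨h, rfl⟩
      refine Eq.trans (FreeMonoid.lift_apply _ _) ?_
      rw [map_one (FreeMonoid.lift _)]
      refine List.prod_eq_one fun x hx => ?_
      obtain ⟨a, ha, rfl⟩ := List.mem_map.1 hx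
      refine if_neg ?_
      rintro rfl
      exact hcon _ h (List.mem_map_of_mem ha))
  have hf : f (PresentedMonoid.of P.Rel ⟨b, hb⟩) = Multiplicative.ofAdd 1 := if_pos rfl
  have hu := (hP.2 (PresentedMonoid.of P.Rel ⟨b, hb⟩)).map f
  rw [hf] at hu
  obtain ⟨y, hy⟩ := hu.exists_right_inv
  have := congrArg Multiplicative.toAdd hy
  simp at this

theorem IsKLGroup.card_le (hP : IsKLGroup k ℓ P) : P.1 ≤ k * ℓ := by
  have h1 : Finset.range P.1 ⊆ P.2.flatten.toFinset := by
    intro b hb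
    obtain ⟨A, hA, hbA⟩ := hP.exists_mem_relator (Finset.mem_range.1 hb)
    exact List.mem_toFinset.2 (List.mem_flatten.2 ⟨A, hA, hbA⟩)
  have h2 := (Finset.card_le_card h1).trans (List.toFinset_card_le _)
  rw [Finset.card_range, List.length_flatten] at h2
  refine h2.trans ((List.sum_le_card_nsmul _ ℓ ?_).trans ?_)
  · intro n hn
    obtain ⟨A, hA, rfl⟩ := List.mem_map.1 hn
    exact (hP.1.2 A hA).1
  · simp [hP.1.1]

theorem finite_setOf_list {α : Type*} {S : Set α} (hS : S.Finite) (m : ℕ) :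
    {L : List α | L.length ≤ m ∧ ∀ a ∈ L, a ∈ S}.Finite := by
  induction m with
  | zero =>
    refine (Set.finite_singleton []).subset ?_
    rintro L ⟨h, -⟩
    exact List.length_eq_zero_iff.1 (Nat.le_zero.1 h)
  | succ m ih =>
    refine ((Set.finite_singleton []).union (hS.image2 List.cons ih)).subset ?_
    rintro L ⟨h, hL⟩
    cases L with
    | nil => exact Or.inl rfl
    | cons a L =>
      exact Or.inr ⟨a, hL a List.mem_cons_self, L,
        ⟨by simpa using h, fun b hb => hL b (List.mem_cons_of_mem _ hb)⟩, rfl⟩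

theorem finite_setOf_isKLGroup (k ℓ : ℕ) : {P | IsKLGroup k ℓ P}.Finite := by
  refine ((Set.finite_Iic (k * ℓ)).prod (finite_setOf_list
    (finite_setOf_list (Set.finite_Iio (k * ℓ)) ℓ) k)).subset ?_
  intro P hP
  refine ⟨hP.card_le, hP.1.1.le, fun A hA => ⟨(hP.1.2 A hA).1, fun a ha => ?_⟩⟩
  exact lt_of_lt_of_le ((hP.1.2 A hA).2 a ha) hP.card_le

/-- Passing to raw words gives the procedures for different presentations a common input type, so
that they can be combined. -/
theorem IdentityProblemDecidable.exists_computable (hP : IdentityProblemDecidable P) :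
    ∃ f : List ℕ × List ℕ → Bool, Computable f ∧
      ∀ u v : List P.Alphabet, f (spell u, spell v) = true ↔ P.WordsEqual u v := by
  obtain ⟨_, hf⟩ := hP
  let conv : List ℕ → List P.Alphabet := fun w =>
    w.filterMap fun n => (Encodable.decode n : Option P.Alphabet)
  have hconv : Primrec conv :=
    Primrec.listFilterMap Primrec.id (Primrec.decode.comp Primrec.snd).to₂
  have hspell : ∀ u : List P.Alphabet, conv (spell u) = u := by
    intro u
    have h : ∀ a : P.Alphabet, (Encodable.decode a.1 : Option P.Alphabet) = some a :=
      fun a => Encodable.encodek a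
    simp only [conv, spell, List.filterMap_map, Function.comp_def, h]
    exact List.filterMap_some
  refine ⟨_, hf.comp ((hconv.comp Primrec.fst).pair (hconv.comp Primrec.snd)).to_comp,
    fun u v => ?_⟩
  simp only [hspell, decide_eq_true_eq]

theorem exists_computable_of_list (L : List SpecialPresentation)
    (hL : ∀ G ∈ L, IdentityProblemDecidable G) :
    ∃ f : SpecialPresentation × List ℕ × List ℕ → Bool, Computable f ∧
      ∀ G ∈ L, ∀ u v : List G.Alphabet, f (G, spell u, spell v) = true ↔ G.WordsEqual u v := by
  induction L with
  | nil => exact ⟨fun _ => true, Computable.const true, by simp⟩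
  | cons G L ih =>
    obtain ⟨f, hf, h⟩ := ih fun H hH => hL H (List.mem_cons_of_mem _ hH)
    obtain ⟨g, hg, h'⟩ := (hL G List.mem_cons_self).exists_computable
    have heq : Primrec fun x : SpecialPresentation × List ℕ × List ℕ => decide (x.1 = G) :=
      (Primrec.eq.comp Primrec.fst (Primrec.const G)).decide
    refine ⟨fun x => bif decide (x.1 = G) then g x.2 else f x,
      Computable.cond heq.to_comp (hg.comp Computable.snd) hf, fun H hH u v => ?_⟩
    by_cases hHG : H = G
    · subst hHG
      simpa using h' u v
    · simpa [hHG] using h H ((List.mem_cons.1 hH).resolve_left hHG) u v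

theorem exists_solvesIdentityProblem
    (h : ∀ G : SpecialPresentation, IsKLGroup k ℓ G → IdentityProblemDecidable G) :
    ∃ c, SolvesIdentityProblem k ℓ c := by
  obtain ⟨f, hf, hfL⟩ := exists_computable_of_list (finite_setOf_isKLGroup k ℓ).toFinset.toList
    fun G hG => h G (by simpa using hG)
  have hval : Computable fun x => bif f x then 1 else 0 :=
    Computable.cond hf (Computable.const 1) (Computable.const 0)
  obtain ⟨c, hc⟩ := Nat.Partrec.Code.exists_code.1 hval
  have heval : ∀ x, c.eval (Encodable.encode x) = Part.some (bif f x then 1 else 0) := by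
    intro x
    simp only [hc, Encodable.encodek, Part.coe_some, Part.bind_some]
    rfl
  refine ⟨c, fun G hG u v => ?_⟩
  have hG' := hfL G (by simpa using hG) u v
  rw [heval]
  refine ⟨fun huv => ?_, fun huv => ?_⟩
  · rw [hG'.2 huv]
    rfl
  · rw [Bool.eq_false_iff.2 fun e => huv (hG'.1 e)]
    rfl

theorem exists_computable_groupOfUnits
    (h : ∀ G : SpecialPresentation, IsKLGroup k ℓ G → IdentityProblemDecidable G) :
    ∃ f : SpecialPresentation → SpecialPresentation, Computable f ∧
      ∀ P : SpecialPresentation, IsKLSemigroup k ℓ P → IsKLGroupOfUnits k ℓ P (f P) := by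
  classical
  obtain ⟨c, hc⟩ := exists_solvesIdentityProblem h
  obtain ⟨F, hF, hFc⟩ := exists_partrec_groupOfUnits
  have hdec : Primrec fun P : SpecialPresentation => decide (IsKLSemigroup k ℓ P) :=
    (primrecPred_isKLSemigroup (Primrec.const k) (Primrec.const ℓ) Primrec.id).decide
  -- Being a `(k, ℓ)`-semigroup is decidable, so the search is started only where it stops;
  -- elsewhere the value is arbitrary.
  let G : SpecialPresentation →. SpecialPresentation := fun P =>
    bif decide (IsKLSemigroup k ℓ P) then F (k, ℓ, c, P) else Part.some P
  have hG : Partrec G := Partrec.cond hdec.to_comp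
    (hF.comp ((Primrec.const k).pair ((Primrec.const ℓ).pair
      ((Primrec.const c).pair Primrec.id))).to_comp) Computable.id
  have hdom : ∀ P, (G P).Dom := by
    intro P
    by_cases hP : IsKLSemigroup k ℓ P
    · obtain ⟨Q, hQ, -⟩ := hFc k ℓ c hc P hP
      exact Part.dom_iff_mem.2 ⟨Q, by simpa [G, hP] using hQ⟩
    · exact Part.dom_iff_mem.2 ⟨P, by simp [G, hP]⟩
  refine ⟨fun P => (G P).get (hdom P), hG.of_eq fun P => (Part.some_get (hdom P)).symm,
    fun P hP => ?_⟩
  obtain ⟨Q, hQ, hQP⟩ := hFc k ℓ c hc P hP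
  have hQG : Q ∈ G P := by simpa [G, hP] using hQ
  simp only
  rwa [Part.get_eq_of_mem hQG]

end SpecialPresentation

open SpecialPresentation in
/-- First part: for all `k` and `ℓ`, if the identity problem is decidable in every `(k, ℓ)`-group,
then there is an algorithm which constructs, from any `(k, ℓ)`-semigroup, a `(k, ℓ)`-group
isomorphic to its maximal subgroup. Second part: this is an effective reduction, uniform in `k`,
`ℓ` and a program that solves the identity problem in all `(k, ℓ)`-groups. -/
theorem theorem7 :
    (∀ k ℓ : ℕ,
      (∀ G : SpecialPresentation, IsKLGroup k ℓ G → IdentityProblemDecidable G) →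
      ∃ f : SpecialPresentation → SpecialPresentation, Computable f ∧
        ∀ P : SpecialPresentation, IsKLSemigroup k ℓ P → IsKLGroupOfUnits k ℓ P (f P)) ∧
    (∃ F : ℕ × ℕ × Nat.Partrec.Code × SpecialPresentation →. SpecialPresentation, Partrec F ∧
      ∀ (k ℓ : ℕ) (c : Nat.Partrec.Code), SolvesIdentityProblem k ℓ c →
        ∀ P : SpecialPresentation, IsKLSemigroup k ℓ P →
          ∃ Q ∈ F (k, ℓ, c, P), IsKLGroupOfUnits k ℓ P Q) := by
  exact ⟨fun _ _ h => exists_computable_groupOfUnits h, exists_partrec_groupOfUnits⟩
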